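/- Rings are associative and need not have a unit; modules over them carry no unit axiom; for a right $R$-module $M$ and a left $R$-module $N$, $M\otimes_RN$ is the quotient of $M\otimes_{\mathbb Z}N$ by the elements $mr\otimes n-m\otimes rn$. A right $R$-module $M$ is firm if the multiplication map $M\otimes_RR\to M$ is bijective (similarly on the left), $R$ is a firm ring if it is firm as a right $R$-module, and $\mathcal M_R$ is the category of firm right $R$-modules and right $R$-linear maps. A firm $R$-$A$-bimodule is an $R$-$A$-bimodule that is firm over $R$ on the left and firm over $A$ on the right. Let $A$ and $R$ be firm rings and let $\Sigma$ be a firm $R$-$A$-bimodule. Put $\Sigma^*=\mathrm{Hom}_A(\Sigma,A)$, an $A$-$R$-bimodule via $(a\varphi)(u)=a\varphi(u)$ and $(\varphi r)(u)=\varphi(ru)$, and let $Z=\Sigma\otimes_A\Sigma^*$ be the ring with multiplication $(u\otimes\varphi)(v\otimes\psi)=u\varphi(v)\otimes\psi$; it acts on $\Sigma$ by $(u\otimes\varphi)v=u\varphi(v)$. The following statements are equivalent. (i) $\Sigma$ is $R$-firmly projective: there is a ring morphism $\iota:R\to Z$ that induces the given left $R$-module structure of $\Sigma$, i.e. $ru=\iota(r)u$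 for all $r\in R$, $u\in\Sigma$ (and $\Sigma$ is firm under this structure). (ii) There are a firm $A$-$R$-bimodule $\Sigma^\dagger$ and a comatrix coring context $(R,A,\Sigma,\Sigma^\dagger,\eta,\varepsilon)$, that is, an $R$-$R$-bilinear map $\eta:R\to\Sigma\otimes_A\Sigma^\dagger$ and an $A$-$A$-bilinear map $\varepsilon:\Sigma^\dagger\otimes_R\Sigma\to A$ such that the composites $$\Sigma\cong R\otimes_R\Sigma\xrightarrow{\eta\otimes_R\Sigma}\Sigma\otimes_A\Sigma^\dagger\otimes_R\Sigma\xrightarrow{\Sigma\otimes_A\varepsilon}\Sigma\otimes_AA\cong\Sigma,$$ $$\Sigma^\dagger\cong\Sigma^\dagger\otimes_RR\xrightarrow{\Sigma^\dagger\otimes_R\eta}\Sigma^\dagger\otimes_R\Sigma\otimes_A\Sigma^\dagger\xrightarrow{\varepsilon\otimes_A\Sigma^\dagger}A\otimes_A\Sigma^\dagger\cong\Sigma^\dagger$$ are the identity maps. (iii) There is a firm $A$-$R$-bimodule $\Sigma^\dagger$ such that $-\otimes_R\Sigma:\mathcal M_R\to\mathcal M_A$ is left adjoint to $-\otimes_A\Sigma^\dagger:\mathcal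 M_A\to\mathcal M_R$. (iv) There are functors $F:\mathcal M_R\to\mathcal M_A$, $G:\mathcal M_A\to\mathcal M_R$ and $H:\mathcal M_R\to\mathcal M_A$ such that $F$ is left adjoint to $G$, $G$ is left adjoint to $H$, and $F(R)\cong\Sigma$ as $R$-$A$-bimodules, where $r\in R$ acts on $F(R)$ as the image under $F$ of the left multiplication by $r$ on $R$. Moreover, for every given firm $A$-$R$-bimodule $\Sigma^\dagger$ the following are equivalent: $\Sigma$ is $R$-firmly projective and $\Sigma^\dagger\cong\Sigma^*\otimes_RR$ as $A$-$R$-bimodules; there is a comatrix coring context $(R,A,\Sigma,\Sigma^\dagger,\eta,\varepsilon)$; $-\otimes_R\Sigma:\mathcal M_R\to\mathcal M_A$ is left adjoint to $-\otimes_A\Sigma^\dagger:\mathcal M_A\to\mathcal M_R$. -/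

import Mathlib

open CategoryTheory
open scoped TensorProduct

universe u

namespace FirmRings

section Modules

/-- A left module over an associative ring which need not have a unit (so no unit axiom). -/
class LeftModule (R M : Type*) [NonUnitalRing R] [AddCommGroup M] where
  lsmul : R → M → M
  lsmul_add : ∀ r m n, lsmul r (m + n) = lsmul r m + lsmul r n
  add_lsmul : ∀ r s m, lsmul (r + s) m = lsmul r m + lsmul s m
  mul_lsmul : ∀ r s m, lsmul (r * s) m = lsmul r (lsmul s m)

/-- A right module over an associative ring which need not have a unit. -/
class RightModule (R M : Type*) [NonUnitalRing R] [AddCommGroup M] where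
  rsmul : M → R → M
  add_rsmul : ∀ m n r, rsmul (m + n) r = rsmul m r + rsmul n r
  rsmul_add : ∀ m r s, rsmul m (r + s) = rsmul m r + rsmul m s
  rsmul_mul : ∀ m r s, rsmul m (r * s) = rsmul (rsmul m r) s

infixr:73 " •ₗ " => LeftModule.lsmul
infixl:73 " •ᵣ " => RightModule.rsmul

/-- A left `R`-module and right `A`-module is an `R`-`A`-bimodule if the two actions commute. -/
class Bimodule (R A M : Type*) [NonUnitalRing R] [NonUnitalRing A] [AddCommGroup M]
    [LeftModule R M] [RightModule A M] : Prop where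
  lsmul_rsmul : ∀ (r : R) (m : M) (a : A), (r •ₗ m) •ᵣ a = r •ₗ (m •ᵣ a)

/-- The left action as a biadditive map. -/
def lactHom (R M : Type*) [NonUnitalRing R] [AddCommGroup M] [LeftModule R M] : R →+ M →+ M :=
  AddMonoidHom.mk' (fun r => AddMonoidHom.mk' (fun m => r •ₗ m) (LeftModule.lsmul_add r))
    (fun r s => by ext m; exact LeftModule.add_lsmul r s m)

/-- The right action as a biadditive map. -/
def ractHom (R M : Type*) [NonUnitalRing R] [AddCommGroup M] [RightModule R M] : M →+ R →+ M :=
  AddMonoidHom.mk' (fun m => AddMonoidHom.mk' (fun r => m •ᵣ r) (RightModule.rsmul_add m))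
    (fun m n => by ext r; exact RightModule.add_rsmul m n r)

@[simp] theorem lactHom_apply {R M : Type*} [NonUnitalRing R] [AddCommGroup M] [LeftModule R M]
    (r : R) (m : M) : lactHom R M r m = r •ₗ m := rfl

@[simp] theorem ractHom_apply {R M : Type*} [NonUnitalRing R] [AddCommGroup M] [RightModule R M]
    (m : M) (r : R) : ractHom R M m r = m •ᵣ r := rfl

/-- Additive maps that respect the left `R`-actions. -/
def IsLeftLinear (R : Type*) {M N : Type*} [NonUnitalRing R] [AddCommGroup M] [AddCommGroup N]
    [LeftModule R M] [LeftModule R N] (f : M →+ N) : Prop :=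
  ∀ (r : R) (m : M), f (r •ₗ m) = r •ₗ f m

/-- Additive maps that respect the right `R`-actions. -/
def IsRightLinear (R : Type*) {M N : Type*} [NonUnitalRing R] [AddCommGroup M] [AddCommGroup N]
    [RightModule R M] [RightModule R N] (f : M →+ N) : Prop :=
  ∀ (m : M) (r : R), f (m •ᵣ r) = f m •ᵣ r

instance (R : Type*) [NonUnitalRing R] : LeftModule R R where
  lsmul r s := r * s
  lsmul_add := mul_add
  add_lsmul := add_mul
  mul_lsmul := mul_assoc

instance (R : Type*) [NonUnitalRing R] : RightModule R R where
  rsmul r s := r * s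
  add_rsmul := add_mul
  rsmul_add := mul_add
  rsmul_mul r s t := (mul_assoc r s t).symm

instance (R : Type*) [NonUnitalRing R] : Bimodule R R R where
  lsmul_rsmul := mul_assoc

end Modules

section Tensor

variable (R : Type*) [NonUnitalRing R]

/-- The subgroup of `M ⊗[ℤ] N` generated by the elements `m r ⊗ n - m ⊗ r n`. -/
def balancing (M N : Type*) [AddCommGroup M] [AddCommGroup N] [RightModule R M]
    [LeftModule R N] : AddSubgroup (M ⊗[ℤ] N) :=
  AddSubgroup.closure
    {x | ∃ (m : M) (r : R) (n : N), x = (m •ᵣ r) ⊗ₜ[ℤ] n - m ⊗ₜ[ℤ] (r •ₗ n)}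

/-- The tensor product `M ⊗_R N` of a right module and a left module over a ring that need
neither be commutative nor have a unit. -/
def Tens (M N : Type*) [AddCommGroup M] [AddCommGroup N] [RightModule R M]
    [LeftModule R N] : Type _ :=
  (M ⊗[ℤ] N) ⧸ balancing R M N

namespace Tens

variable {M N P M' N' : Type*} [AddCommGroup M] [AddCommGroup N] [AddCommGroup P]
  [AddCommGroup M'] [AddCommGroup N']
  [RightModule R M] [LeftModule R N] [RightModule R M'] [LeftModule R N']

instance : AddCommGroup (Tens R M N) :=
  inferInstanceAs (AddCommGroup ((M ⊗[ℤ] N) ⧸ balancing R M N))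

/-- The pure tensor `m ⊗_R n`. -/
def tmul (m : M) (n : N) : Tens R M N := QuotientAddGroup.mk' (balancing R M N) (m ⊗ₜ[ℤ] n)

theorem add_tmul (m m' : M) (n : N) : tmul R (m + m') n = tmul R m n + tmul R m' n := by
  unfold tmul; rw [TensorProduct.add_tmul, map_add]; rfl

theorem tmul_add (m : M) (n n' : N) : tmul R m (n + n') = tmul R m n + tmul R m n' := by
  unfold tmul; rw [TensorProduct.tmul_add, map_add]; rfl

theorem rsmul_tmul (m : M) (r : R) (n : N) : tmul R (m •ᵣ r) n = tmul R m (r •ₗ n) := by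
  refine (QuotientAddGroup.eq_iff_sub_mem (N := balancing R M N)).2 ?_
  exact AddSubgroup.subset_closure ⟨m, r, n, rfl⟩

/-- `tmul` as a biadditive map. -/
def mk (M N : Type*) [AddCommGroup M] [AddCommGroup N] [RightModule R M] [LeftModule R N] :
    M →+ N →+ Tens R M N :=
  AddMonoidHom.mk' (fun m => AddMonoidHom.mk' (fun n => tmul R m n) (tmul_add R m))
    (fun m m' => by ext n; exact add_tmul R m m' n)

@[simp] theorem mk_apply (m : M) (n : N) : mk R M N m n = tmul R m n := rfl

/-- The additive map out of `M ⊗_R N` given by an `R`-balanced biadditive map. -/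
def lift (f : M →+ N →+ P) (hf : ∀ m (r : R) n, f (m •ᵣ r) n = f m (r •ₗ n)) :
    Tens R M N →+ P :=
  QuotientAddGroup.lift (balancing R M N)
    (TensorProduct.liftAddHom f (fun z m n => by simp))
    (by
      rw [balancing, AddSubgroup.closure_le]
      rintro _ ⟨m, r, n, rfl⟩
      simp [hf])

@[simp] theorem lift_tmul (f : M →+ N →+ P) (hf : ∀ m (r : R) n, f (m •ᵣ r) n = f m (r •ₗ n))
    (m : M) (n : N) : lift R f hf (tmul R m n) = f m n := rfl

theorem induction {p : Tens R M N → Prop} (h0 : p 0) (ht : ∀ m n, p (tmul R m n))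
    (ha : ∀ x y, p x → p y → p (x + y)) (x : Tens R M N) : p x := by
  obtain ⟨y, rfl⟩ := QuotientAddGroup.mk'_surjective (balancing R M N) x
  induction y using TensorProduct.induction_on with
  | zero => rw [map_zero]; exact h0
  | tmul m n => exact ht m n
  | add a b iha ihb => rw [map_add]; exact ha _ _ iha ihb

theorem hom_ext {f g : Tens R M N →+ P} (h : ∀ m n, f (tmul R m n) = g (tmul R m n)) :
    f = g := by
  ext x
  induction x using induction with
  | h0 => simp
  | ht m n => exact h m n
  | ha x y hx hy => simp [hx, hy]

/-- `f ⊗_R g` for a right linear map `f` and a left linear map `g`. -/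
def map (f : M →+ M') (g : N →+ N') (hf : IsRightLinear R f) (hg : IsLeftLinear R g) :
    Tens R M N →+ Tens R M' N' :=
  lift R (((mk R M' N').comp f).compl₂ g)
    (fun m r n => by
      simp only [AddMonoidHom.compl₂_apply, AddMonoidHom.comp_apply, mk_apply]
      rw [hf, hg, rsmul_tmul])

@[simp] theorem map_tmul (f : M →+ M') (g : N →+ N') (hf : IsRightLinear R f)
    (hg : IsLeftLinear R g) (m : M) (n : N) :
    map R f g hf hg (tmul R m n) = tmul R (f m) (g n) := rfl

end Tens

theorem IsLeftLinear.id {M : Type*} [AddCommGroup M] [LeftModule R M] :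
    IsLeftLinear R (AddMonoidHom.id M) := fun _ _ => rfl

theorem IsRightLinear.id {M : Type*} [AddCommGroup M] [RightModule R M] :
    IsRightLinear R (AddMonoidHom.id M) := fun _ _ => rfl

section Actions

variable {S M N : Type*} [NonUnitalRing S] [AddCommGroup M] [AddCommGroup N]
  [RightModule R M] [LeftModule R N]

theorem lactHom_rightLinear [LeftModule S M] [Bimodule S R M] (s : S) :
    IsRightLinear R (lactHom S M s) := fun m r => (Bimodule.lsmul_rsmul s m r).symm

theorem ractHom_leftLinear [RightModule S N] [Bimodule R S N] (s : S) :
    IsLeftLinear R ((ractHom S N).flip s) := fun r n => Bimodule.lsmul_rsmul r n s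

/-- `s (m ⊗ n) = (s m) ⊗ n`. -/
instance [LeftModule S M] [Bimodule S R M] : LeftModule S (Tens R M N) where
  lsmul s := Tens.map R (lactHom S M s) (AddMonoidHom.id N)
    (lactHom_rightLinear R s) (IsLeftLinear.id R)
  lsmul_add s := map_add _
  add_lsmul s t x := by
    induction x using Tens.induction with
    | h0 => simp only [map_zero, add_zero]
    | ht m n =>
      change Tens.tmul R ((s + t) •ₗ m) n = Tens.tmul R (s •ₗ m) n + Tens.tmul R (t •ₗ m) n
      rw [LeftModule.add_lsmul, Tens.add_tmul]
    | ha x y hx hy => rw [map_add, hx, hy, map_add, map_add, add_add_add_comm]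
  mul_lsmul s t x := by
    induction x using Tens.induction with
    | h0 => simp only [map_zero]
    | ht m n => exact congrArg (fun m => Tens.tmul R m n) (LeftModule.mul_lsmul s t m)
    | ha x y hx hy => rw [map_add, map_add, map_add, hx, hy]

/-- `(m ⊗ n) s = m ⊗ (n s)`. -/
instance [RightModule S N] [Bimodule R S N] : RightModule S (Tens R M N) where
  rsmul x s := Tens.map R (AddMonoidHom.id M) ((ractHom S N).flip s)
    (IsRightLinear.id R) (ractHom_leftLinear R s) x
  add_rsmul x y s := map_add _ x y
  rsmul_add x s t := by
    induction x using Tens.induction with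
    | h0 => simp only [map_zero, add_zero]
    | ht m n =>
      change Tens.tmul R m (n •ᵣ (s + t)) = Tens.tmul R m (n •ᵣ s) + Tens.tmul R m (n •ᵣ t)
      rw [RightModule.rsmul_add, Tens.tmul_add]
    | ha x y hx hy => rw [map_add, hx, hy, map_add, map_add, add_add_add_comm]
  rsmul_mul x s t := by
    induction x using Tens.induction with
    | h0 => simp only [map_zero]
    | ht m n => exact congrArg (Tens.tmul R m) (RightModule.rsmul_mul n s t)
    | ha x y hx hy => rw [map_add, map_add, map_add, hx, hy]

@[simp] theorem Tens.lsmul_tmul [LeftModule S M] [Bimodule S R M] (s : S) (m : M) (n : N) :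
    s •ₗ tmul R m n = tmul R (s •ₗ m) n := rfl

@[simp] theorem Tens.tmul_rsmul [RightModule S N] [Bimodule R S N] (s : S) (m : M) (n : N) :
    tmul R m n •ᵣ s = tmul R m (n •ᵣ s) := rfl

theorem lsmul_zero' (s : S) [LeftModule S M] : s •ₗ (0 : M) = 0 := map_zero (lactHom S M s)

theorem zero_rsmul' (s : S) [RightModule S M] : (0 : M) •ᵣ s = 0 := by
  rw [← ractHom_apply, map_zero]; rfl

instance {T : Type*} [NonUnitalRing T] [LeftModule S M] [Bimodule S R M] [RightModule T N]
    [Bimodule R T N] : Bimodule S T (Tens R M N) where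
  lsmul_rsmul s x t := by
    induction x using Tens.induction with
    | h0 => simp only [lsmul_zero', zero_rsmul']
    | ht m n => rfl
    | ha x y hx hy => simp only [LeftModule.lsmul_add, RightModule.add_rsmul, hx, hy]

end Actions

/-- The map `(m ⊗ n) ⊗ p ↦ m ⊗ (n ⊗ p)`. -/
def Tens.assocHom (A M N P : Type*) [NonUnitalRing A] [AddCommGroup M] [AddCommGroup N]
    [AddCommGroup P] [RightModule A M] [LeftModule A N] [RightModule R N] [Bimodule A R N]
    [LeftModule R P] : Tens R (Tens A M N) P →+ Tens A M (Tens R N P) :=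
  lift R
    (lift A
      (AddMonoidHom.mk' (fun m => AddMonoidHom.mk'
          (fun n => (mk A M (Tens R N P) m).comp (mk R N P n))
          (fun n n' => AddMonoidHom.ext fun p =>
            (congrArg (tmul A m) (add_tmul R n n' p)).trans (tmul_add A m _ _)))
        (fun m m' => AddMonoidHom.ext fun n => AddMonoidHom.ext fun p => add_tmul A m m' _))
      (fun m a n => AddMonoidHom.ext fun p => rsmul_tmul A m a (tmul R n p)))
    (fun x r p => by
      induction x using Tens.induction with
      | h0 => rw [zero_rsmul', map_zero]; rfl
      | ht m n => exact congrArg (tmul A m) (rsmul_tmul R n r p)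
      | ha x y hx hy =>
        rw [RightModule.add_rsmul, map_add, map_add, AddMonoidHom.add_apply,
          AddMonoidHom.add_apply, hx, hy])

/-- The map `m ⊗ (n ⊗ p) ↦ (m ⊗ n) ⊗ p`. -/
def Tens.assocInv (A M N P : Type*) [NonUnitalRing A] [AddCommGroup M] [AddCommGroup N]
    [AddCommGroup P] [RightModule A M] [LeftModule A N] [RightModule R N] [Bimodule A R N]
    [LeftModule R P] : Tens A M (Tens R N P) →+ Tens R (Tens A M N) P :=
  lift A
    (AddMonoidHom.mk' (fun m => lift R ((mk R (Tens A M N) P).comp (mk A M N m))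
        (fun n r p => rsmul_tmul R (tmul A m n) r p))
      (fun m m' => Tens.hom_ext R fun n p =>
        (congrArg (fun x => tmul R x p) (add_tmul A m m' n)).trans (add_tmul R _ _ p)))
    (fun m a x => by
      induction x using Tens.induction with
      | h0 => rw [lsmul_zero', map_zero, map_zero]
      | ht n p => exact congrArg (fun x => tmul R x p) (rsmul_tmul A m a n)
      | ha x y hx hy => rw [LeftModule.lsmul_add, map_add, map_add, hx, hy])

/-- The associativity isomorphism `(M ⊗_A N) ⊗_R P ≅ M ⊗_A (N ⊗_R P)`. -/
def Tens.assoc (A M N P : Type*) [NonUnitalRing A] [AddCommGroup M] [AddCommGroup N]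
    [AddCommGroup P] [RightModule A M] [LeftModule A N] [RightModule R N] [Bimodule A R N]
    [LeftModule R P] : Tens R (Tens A M N) P ≃+ Tens A M (Tens R N P) :=
  AddMonoidHom.toAddEquiv (assocHom R A M N P) (assocInv R A M N P)
    (Tens.hom_ext R (fun x p => by
      induction x using Tens.induction with
      | h0 => simp only [← Tens.mk_apply, map_zero, AddMonoidHom.zero_apply]
      | ht m n => rfl
      | ha x y hx hy => rw [Tens.add_tmul, map_add, map_add, hx, hy]))
    (Tens.hom_ext A (fun m x => by
      induction x using Tens.induction with
      | h0 => simp only [← Tens.mk_apply, map_zero]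
      | ht m n => rfl
      | ha x y hx hy => rw [Tens.tmul_add, map_add, map_add, hx, hy]))

@[simp] theorem Tens.assoc_tmul {A M N P : Type*} [NonUnitalRing A] [AddCommGroup M]
    [AddCommGroup N] [AddCommGroup P] [RightModule A M] [LeftModule A N] [RightModule R N]
    [Bimodule A R N] [LeftModule R P] (m : M) (n : N) (p : P) :
    assoc R A M N P (tmul R (tmul A m n) p) = tmul A m (tmul R n p) := rfl

@[simp] theorem Tens.assoc_symm_tmul {A M N P : Type*} [NonUnitalRing A] [AddCommGroup M]
    [AddCommGroup N] [AddCommGroup P] [RightModule A M] [LeftModule A N] [RightModule R N]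
    [Bimodule A R N] [LeftModule R P] (m : M) (n : N) (p : P) :
    (assoc R A M N P).symm (tmul A m (tmul R n p)) = tmul R (tmul A m n) p := rfl

end Tensor

section Firm

/-- The multiplication map `R ⊗_R M → M`. -/
def lmulMap (R M : Type*) [NonUnitalRing R] [AddCommGroup M] [LeftModule R M] :
    Tens R R M →+ M :=
  Tens.lift R (lactHom R M) (fun s r m => LeftModule.mul_lsmul s r m)

/-- The multiplication map `M ⊗_R R → M`. -/
def rmulMap (R M : Type*) [NonUnitalRing R] [AddCommGroup M] [RightModule R M] :
    Tens R M R →+ M :=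
  Tens.lift R (ractHom R M) (fun m r s => (RightModule.rsmul_mul m r s).symm)

@[simp] theorem lmulMap_tmul {R M : Type*} [NonUnitalRing R] [AddCommGroup M] [LeftModule R M]
    (r : R) (m : M) : lmulMap R M (Tens.tmul R r m) = r •ₗ m := rfl

@[simp] theorem rmulMap_tmul {R M : Type*} [NonUnitalRing R] [AddCommGroup M] [RightModule R M]
    (m : M) (r : R) : rmulMap R M (Tens.tmul R m r) = m •ᵣ r := rfl

/-- Firm left modules. -/
def IsLeftFirm (R M : Type*) [NonUnitalRing R] [AddCommGroup M] [LeftModule R M] : Prop :=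
  Function.Bijective (lmulMap R M)

/-- Firm right modules. -/
def IsRightFirm (R M : Type*) [NonUnitalRing R] [AddCommGroup M] [RightModule R M] : Prop :=
  Function.Bijective (rmulMap R M)

/-- Firm rings: `R` is firm as a right module over itself. -/
def IsFirmRing (R : Type*) [NonUnitalRing R] : Prop := IsRightFirm R R

/-- If `N` is an `R`-`A`-bimodule that is firm over `A`, then so is `M ⊗_R N`. -/
theorem IsRightFirm.tens (R A M N : Type*) [NonUnitalRing R] [NonUnitalRing A] [AddCommGroup M]
    [AddCommGroup N] [RightModule R M] [LeftModule R N] [RightModule A N] [Bimodule R A N]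
    (h : IsRightFirm A N) : IsRightFirm A (Tens R M N) := by
  let e : Tens A N A ≃+ N := AddEquiv.ofBijective (rmulMap A N) h
  have he : IsLeftLinear R e.toAddMonoidHom := by
    intro r x
    induction x using Tens.induction with
    | h0 => rw [lsmul_zero', map_zero, lsmul_zero']
    | ht n a => exact Bimodule.lsmul_rsmul r n a
    | ha x y hx hy => simp only [LeftModule.lsmul_add, map_add, hx, hy]
  have he' : IsLeftLinear R e.symm.toAddMonoidHom := by
    intro r x
    apply e.injective
    have := he r (e.symm x)
    simpa using this.symm
  let f := Tens.map R (AddMonoidHom.id M) e.toAddMonoidHom (IsRightLinear.id R) he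
  let g := Tens.map R (AddMonoidHom.id M) e.symm.toAddMonoidHom (IsRightLinear.id R) he'
  have hgf : g.comp f = AddMonoidHom.id _ := Tens.hom_ext R (fun m n => by simp [f, g])
  have hfg : f.comp g = AddMonoidHom.id _ := Tens.hom_ext R (fun m n => by simp [f, g])
  let k := AddMonoidHom.toAddEquiv f g hgf hfg
  have : rmulMap A (Tens R M N) = f.comp (Tens.assoc A R M N A).toAddMonoidHom :=
    Tens.hom_ext A (fun x a => by
      induction x using Tens.induction with
      | h0 => simp only [← Tens.mk_apply, map_zero, AddMonoidHom.zero_apply]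
      | ht m n => rfl
      | ha x y hx hy => simp only [Tens.add_tmul, map_add, hx, hy])
  unfold IsRightFirm
  rw [this]
  exact k.bijective.comp (Tens.assoc A R M N A).bijective

end Firm

section Bimodules

/-- Firm `R`-`A`-bimodules: bimodules that are firm on the left over `R` and firm on the right
over `A`. -/
structure FirmBimodule (R A : Type u) [NonUnitalRing R] [NonUnitalRing A] where
  carrier : Type u
  [addCommGroup : AddCommGroup carrier]
  [leftModule : LeftModule R carrier]
  [rightModule : RightModule A carrier]
  [bimodule : Bimodule R A carrier]
  leftFirm : IsLeftFirm R carrier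
  rightFirm : IsRightFirm A carrier

attribute [instance] FirmBimodule.addCommGroup FirmBimodule.leftModule
  FirmBimodule.rightModule FirmBimodule.bimodule

instance (R A : Type u) [NonUnitalRing R] [NonUnitalRing A] :
    CoeSort (FirmBimodule R A) (Type u) := ⟨FirmBimodule.carrier⟩

/-- Additive maps that respect the left `R`-action and the right `A`-action. -/
def IsBilinear (R A : Type*) {M N : Type*} [NonUnitalRing R] [NonUnitalRing A] [AddCommGroup M]
    [AddCommGroup N] [LeftModule R M] [LeftModule R N] [RightModule A M] [RightModule A N]
    (f : M →+ N) : Prop :=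
  IsLeftLinear R f ∧ IsRightLinear A f

/-- Bimodules `M` and `N` are isomorphic. -/
def BimoduleIso (R A M N : Type*) [NonUnitalRing R] [NonUnitalRing A] [AddCommGroup M]
    [AddCommGroup N] [LeftModule R M] [LeftModule R N] [RightModule A M] [RightModule A N] :
    Prop :=
  ∃ e : M ≃+ N, IsBilinear R A e.toAddMonoidHom

end Bimodules

section Dual

variable (A M : Type*) [NonUnitalRing A] [AddCommGroup M] [RightModule A M]

/-- The dual `M* = Hom_A(M, A)` of a right `A`-module: the right `A`-linear maps `M → A`. -/
def Dual : AddSubgroup (M →+ A) where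
  carrier := {f | IsRightLinear A f}
  zero_mem' := fun _ a => (zero_mul a).symm
  add_mem' := fun {f g} hf hg m a => by
    rw [AddMonoidHom.add_apply, AddMonoidHom.add_apply, hf, hg, RightModule.add_rsmul]
  neg_mem' := fun {f} hf m a => by
    rw [AddMonoidHom.neg_apply, AddMonoidHom.neg_apply, hf]
    exact (neg_mul (f m) a).symm

variable {A M}

/-- `(a φ)(m) = a φ(m)`. -/
instance : LeftModule A (Dual A M) where
  lsmul a φ := ⟨(AddMonoidHom.mulLeft a).comp φ.1, fun m b => by
    rw [AddMonoidHom.comp_apply, φ.2]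
    exact (mul_assoc a (φ.1 m) b).symm⟩
  lsmul_add a φ ψ := by ext m; exact mul_add a (φ.1 m) (ψ.1 m)
  add_lsmul a b φ := by ext m; exact add_mul a b (φ.1 m)
  mul_lsmul a b φ := by ext m; exact mul_assoc a b (φ.1 m)

/-- `(φ r)(m) = φ(r m)`. -/
instance {R : Type*} [NonUnitalRing R] [LeftModule R M] [Bimodule R A M] :
    RightModule R (Dual A M) where
  rsmul φ r := ⟨φ.1.comp (lactHom R M r), fun m a => by
    rw [AddMonoidHom.comp_apply, AddMonoidHom.comp_apply, lactHom_apply, lactHom_apply,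
      ← Bimodule.lsmul_rsmul, φ.2]⟩
  add_rsmul φ ψ r := rfl
  rsmul_add φ r s := by
    ext m
    change φ.1 ((r + s) •ₗ m) = φ.1 (r •ₗ m) + φ.1 (s •ₗ m)
    rw [LeftModule.add_lsmul, map_add]
  rsmul_mul φ r s := by
    ext m
    exact congrArg φ.1 (LeftModule.mul_lsmul r s m)

instance {R : Type*} [NonUnitalRing R] [LeftModule R M] [Bimodule R A M] :
    Bimodule A R (Dual A M) where
  lsmul_rsmul _ _ _ := rfl

variable (A M)

/-- The elementary ring `Z = M ⊗_A M*`. -/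
def ElementaryRing : Type _ := Tens A M (Dual A M)

namespace ElementaryRing

instance : AddCommGroup (ElementaryRing A M) := inferInstanceAs (AddCommGroup (Tens A M _))

variable {A M} in
/-- The element `u ⊗ φ` of `Z`. -/
def tmul (u : M) (φ : Dual A M) : ElementaryRing A M := Tens.tmul A u φ

variable {A M} in
theorem induction {p : ElementaryRing A M → Prop} (h0 : p 0) (ht : ∀ u φ, p (tmul u φ))
    (ha : ∀ x y, p x → p y → p (x + y)) (x : ElementaryRing A M) : p x :=
  Tens.induction A h0 ht ha x

/-- The action of `Z` on `M`: `(u ⊗ φ) v = u φ(v)`. -/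
def act : ElementaryRing A M →+ M →+ M :=
  Tens.lift A
    (AddMonoidHom.mk' (fun u => AddMonoidHom.mk' (fun φ : Dual A M => (ractHom A M u).comp φ.1)
        (fun φ ψ => by ext v; exact RightModule.rsmul_add u (φ.1 v) (ψ.1 v)))
      (fun u u' => by ext φ v; exact RightModule.add_rsmul u u' (φ.1 v)))
    (fun u a φ => by ext v; exact (RightModule.rsmul_mul u a (φ.1 v)).symm)

theorem act_tmul (u : M) (φ : Dual A M) (v : M) : act A M (tmul u φ) v = u •ᵣ φ.1 v := rfl

theorem act_rightLinear (z : ElementaryRing A M) : IsRightLinear A (act A M z) := by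
  intro v a
  induction z using induction with
  | h0 => exact (zero_rsmul' a).symm
  | ht u φ =>
    rw [act_tmul, act_tmul, φ.2]
    exact RightModule.rsmul_mul u (φ.1 v) a
  | ha x y hx hy =>
    rw [map_add, AddMonoidHom.add_apply, AddMonoidHom.add_apply, RightModule.add_rsmul, hx, hy]

/-- Left multiplication by `z`, that is, `z (v ⊗ ψ) = (z v) ⊗ ψ`; in particular
`(u ⊗ φ) (v ⊗ ψ) = u φ(v) ⊗ ψ`. -/
def mulLeft (z : ElementaryRing A M) : ElementaryRing A M →+ ElementaryRing A M :=
  Tens.map A (act A M z) (AddMonoidHom.id _) (act_rightLinear A M z) (IsLeftLinear.id A)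

theorem mulLeft_tmul (z : ElementaryRing A M) (v : M) (ψ : Dual A M) :
    mulLeft A M z (tmul v ψ) = tmul (act A M z v) ψ := rfl

theorem mulLeft_add (z w x : ElementaryRing A M) :
    mulLeft A M (z + w) x = mulLeft A M z x + mulLeft A M w x := by
  induction x using induction with
  | h0 => simp
  | ht v ψ =>
    rw [mulLeft_tmul, mulLeft_tmul, mulLeft_tmul, map_add]
    exact Tens.add_tmul A _ _ ψ
  | ha x y hx hy => rw [map_add, map_add, map_add, hx, hy, add_add_add_comm]

theorem act_mulLeft (z w : ElementaryRing A M) (v : M) :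
    act A M (mulLeft A M z w) v = act A M z (act A M w v) := by
  induction w using induction with
  | h0 => simp
  | ht u φ =>
    rw [mulLeft_tmul, act_tmul, act_tmul]
    exact (act_rightLinear A M z u (φ.1 v)).symm
  | ha x y hx hy =>
    rw [map_add, map_add, map_add, AddMonoidHom.add_apply, AddMonoidHom.add_apply, map_add, hx, hy]

instance : NonUnitalRing (ElementaryRing A M) :=
  { (inferInstance : AddCommGroup (ElementaryRing A M)) with
    mul := fun z w => mulLeft A M z w
    left_distrib := fun z => map_add (mulLeft A M z)
    right_distrib := mulLeft_add A M
    zero_mul := fun x => by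
      change mulLeft A M 0 x = 0
      simpa using mulLeft_add A M 0 0 x
    mul_zero := fun z => map_zero (mulLeft A M z)
    mul_assoc := fun z w x => by
      change mulLeft A M (mulLeft A M z w) x = mulLeft A M z (mulLeft A M w x)
      induction x using induction with
      | h0 => simp
      | ht u φ => rw [mulLeft_tmul, mulLeft_tmul, mulLeft_tmul, act_mulLeft]
      | ha x y hx hy => rw [map_add, map_add, map_add, hx, hy] }

instance : LeftModule (ElementaryRing A M) M where
  lsmul z v := act A M z v
  lsmul_add z := map_add (act A M z)
  add_lsmul z w v := by rw [map_add]; rfl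
  mul_lsmul z w v := act_mulLeft A M z w v

end ElementaryRing

/-- `R`-firm projectivity of an `R`-`A`-bimodule `M`: there is a ring morphism
`ι : R → Z = M ⊗_A M*` that induces the left `R`-module structure of `M`, and `M` is firm as a left
`R`-module under this structure. -/
def IsFirmlyProjective (R : Type*) [NonUnitalRing R] [LeftModule R M] [Bimodule R A M] : Prop :=
  ∃ ι : R →ₙ+* ElementaryRing A M, (∀ (r : R) (u : M), r •ₗ u = ι r •ₗ u) ∧ IsLeftFirm R M

end Dual

section Context

/-- Comatrix coring contexts `(R, A, S, T, η, ε)`. The two commutative diagrams are written with the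
multiplication isomorphisms `R ⊗_R S ≅ S`, `S ⊗_A A ≅ S`, `T ⊗_R R ≅ T` and `A ⊗_A T ≅ T` instead of
their inverses. -/
structure ComatrixCoringContext (R A : Type u) [NonUnitalRing R] [NonUnitalRing A]
    (S : FirmBimodule R A) (T : FirmBimodule A R) where
  η : R →+ Tens A S T
  ε : Tens R T S →+ A
  η_bilinear : IsBilinear R R η
  ε_bilinear : IsBilinear A A ε
  left_comm : ∀ x : Tens R R S,
    rmulMap A S
      (Tens.map A (AddMonoidHom.id S) ε (IsRightLinear.id A) ε_bilinear.1
        (Tens.assoc R A S T S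
          (Tens.map R η (AddMonoidHom.id S) η_bilinear.2 (IsLeftLinear.id R) x))) =
    lmulMap R S x
  right_comm : ∀ x : Tens R T R,
    lmulMap A T
      (Tens.map A ε (AddMonoidHom.id T) ε_bilinear.2 (IsLeftLinear.id A)
        ((Tens.assoc A R T S T).symm
          (Tens.map R (AddMonoidHom.id T) η (IsRightLinear.id R) η_bilinear.1 x))) =
    rmulMap R T x

end Context

section Categories

/-- The objects of the category of firm right `R`-modules. -/
structure FirmMod (R : Type u) [NonUnitalRing R] where
  carrier : Type u
  [addCommGroup : AddCommGroup carrier]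
  [rightModule : RightModule R carrier]
  firm : IsRightFirm R carrier

attribute [instance] FirmMod.addCommGroup FirmMod.rightModule

namespace FirmMod

instance (R : Type u) [NonUnitalRing R] : CoeSort (FirmMod R) (Type u) := ⟨FirmMod.carrier⟩

/-- Morphisms of firm right modules: the right linear maps. -/
@[ext]
structure Hom {R : Type u} [NonUnitalRing R] (M N : FirmMod R) where
  hom : M →+ N
  linear : IsRightLinear R hom

instance (R : Type u) [NonUnitalRing R] : Category (FirmMod R) where
  Hom M N := Hom M N
  id M := ⟨AddMonoidHom.id M, IsRightLinear.id R⟩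
  comp f g := ⟨g.hom.comp f.hom, fun m r => by
    rw [AddMonoidHom.comp_apply, f.linear, g.linear]; rfl⟩

/-- A firm ring as a firm right module over itself. -/
def self (R : Type u) [NonUnitalRing R] (hR : IsFirmRing R) : FirmMod R := ⟨R, hR⟩

/-- Left multiplication by `r`, as an endomorphism of the right module `R`. -/
def mulLeft {R : Type u} [NonUnitalRing R] (hR : IsFirmRing R) (r : R) : self R hR ⟶ self R hR :=
  Hom.mk (M := self R hR) (N := self R hR) (AddMonoidHom.mulLeft r)
    (fun m s => (mul_assoc r m s).symm)

/-- The functor `- ⊗_R S` from firm right `R`-modules to firm right `A`-modules. -/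
def tensFunctor {R A : Type u} [NonUnitalRing R] [NonUnitalRing A] (S : FirmBimodule R A) :
    FirmMod R ⥤ FirmMod A where
  obj M := ⟨Tens R M S, IsRightFirm.tens R A M S S.rightFirm⟩
  map f := Hom.mk (Tens.map R f.hom (AddMonoidHom.id S) f.linear (IsLeftLinear.id R))
    (fun x a => by
      induction x using Tens.induction with
      | h0 => rw [zero_rsmul', map_zero, zero_rsmul']
      | ht m n => rfl
      | ha x y hx hy => rw [RightModule.add_rsmul, map_add, map_add, RightModule.add_rsmul, hx, hy])
  map_id M := Hom.ext (Tens.hom_ext R (fun _ _ => rfl))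
  map_comp f g := Hom.ext (Tens.hom_ext R (fun _ _ => rfl))

end FirmMod

/-- `F(R)` is isomorphic to `S` as an `R`-`A`-bimodule, where `r ∈ R` acts from the left on `F(R)` as
the image under `F` of the left multiplication by `r`. -/
def ValueAtRingIso {R A : Type u} [NonUnitalRing R] [NonUnitalRing A] (hR : IsFirmRing R)
    (F : FirmMod R ⥤ FirmMod A) (S : FirmBimodule R A) : Prop :=
  ∃ e : F.obj (FirmMod.self R hR) ≃+ S,
    IsRightLinear A e.toAddMonoidHom ∧
    ∀ (r : R) (x : F.obj (FirmMod.self R hR)),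
      e ((F.map (FirmMod.mulLeft hR r)).hom x) = r •ₗ e x

/-- There is a triple `(F, G, H)` of adjoint functors between the categories of firm right modules
over `R` and over `A` such that `F(R) = S`. -/
def HasAdjointTriple {R A : Type u} [NonUnitalRing R] [NonUnitalRing A] (hR : IsFirmRing R)
    (S : FirmBimodule R A) : Prop :=
  ∃ (F : FirmMod R ⥤ FirmMod A) (G : FirmMod A ⥤ FirmMod R) (H : FirmMod R ⥤ FirmMod A),
    Nonempty (F ⊣ G) ∧ Nonempty (G ⊣ H) ∧ ValueAtRingIso hR F S

end Categories

end FirmRings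

open FirmRings

/-! A pairing `ε : T ⊗_R S → A` amounts to a map `j : T → S*`, and in terms of `j` the triangles of
a comatrix coring context say that every `η r ∈ S ⊗_A T` acts on `S` and on `T` as multiplication
by `r`. As `R` is firm, such an `η` exists as soon as `R` maps to `S ⊗_A S*` compatibly with its
action on `S`, and it forces `T ≅ S* ⊗_R R`. On the other hand `η` and `j` generate the unit and
the counit of an adjunction `- ⊗_R S ⊣ - ⊗_A T`, and they are recovered from any such adjunction by
evaluating at `R` and at `A`, because a firm module `M` is covered by the maps `R → M`, `r ↦ m r`.

The functor `- ⊗_A T` always has the right adjoint `Hom_R(T, -) ⊗_A A`. Conversely, a left adjoint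
functor `F` between categories of firm modules is isomorphic to `- ⊗_R F(R)`, so that adjoint
triples are made of tensor functors. -/

namespace FirmRings

section Linearity

variable {R S M N P : Type*} [NonUnitalRing R] [NonUnitalRing S] [AddCommGroup M] [AddCommGroup N]
  [AddCommGroup P]

theorem IsLeftLinear.comp [LeftModule R M] [LeftModule R N] [LeftModule R P] {g : N →+ P}
    {f : M →+ N} (hg : IsLeftLinear R g) (hf : IsLeftLinear R f) : IsLeftLinear R (g.comp f) :=
  fun r m => (congrArg g (hf r m)).trans (hg r (f m))

theorem IsRightLinear.comp [RightModule R M] [RightModule R N] [RightModule R P] {g : N →+ P}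
    {f : M →+ N} (hg : IsRightLinear R g) (hf : IsRightLinear R f) : IsRightLinear R (g.comp f) :=
  fun m r => (congrArg g (hf m r)).trans (hg (f m) r)

theorem IsLeftLinear.symm [LeftModule R M] [LeftModule R N] {e : M ≃+ N}
    (he : IsLeftLinear R e.toAddMonoidHom) : IsLeftLinear R e.symm.toAddMonoidHom := fun r n =>
  (e.symm_apply_eq).2 (((he r (e.symm n)).trans (congrArg (r •ₗ ·) (e.apply_symm_apply n))).symm)

theorem IsRightLinear.symm [RightModule R M] [RightModule R N] {e : M ≃+ N}
    (he : IsRightLinear R e.toAddMonoidHom) : IsRightLinear R e.symm.toAddMonoidHom := fun n r =>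
  (e.symm_apply_eq).2 (((he (e.symm n) r).trans (congrArg (· •ᵣ r) (e.apply_symm_apply n))).symm)

namespace Tens

variable {A M' N' : Type*} [NonUnitalRing A] [AddCommGroup M'] [AddCommGroup N'] [RightModule R M]
  [RightModule R M'] [LeftModule R N] [LeftModule R N']

theorem zero_tmul (n : N) : tmul R (0 : M) n = 0 := DFunLike.congr_fun (map_zero (mk R M N)) n

theorem leftLinear_of_tmul [LeftModule S M] [Bimodule S R M] [LeftModule S P]
    {f : Tens R M N →+ P} (h : ∀ (s : S) m n, f (tmul R (s •ₗ m) n) = s •ₗ f (tmul R m n)) :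
    IsLeftLinear S f := fun s =>
  DFunLike.congr_fun (hom_ext R (f := f.comp (lactHom S _ s)) (g := (lactHom S P s).comp f) (h s))

theorem rightLinear_of_tmul [RightModule S N] [Bimodule R S N] [RightModule S P]
    {f : Tens R M N →+ P} (h : ∀ m n (s : S), f (tmul R m (n •ᵣ s)) = f (tmul R m n) •ᵣ s) :
    IsRightLinear S f := fun x s =>
  DFunLike.congr_fun (hom_ext R (f := f.comp ((ractHom S _).flip s))
    (g := ((ractHom S P).flip s).comp f) fun m n => h m n s) x

theorem map_leftLinear [LeftModule S M] [LeftModule S M'] [Bimodule S R M] [Bimodule S R M']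
    {f : M →+ M'} {g : N →+ N'} (hf : IsRightLinear R f) (hg : IsLeftLinear R g)
    (hf' : IsLeftLinear S f) : IsLeftLinear S (map R f g hf hg) :=
  leftLinear_of_tmul fun s m n => congrArg (tmul R · (g n)) (hf' s m)

theorem map_rightLinear [RightModule S N] [RightModule S N'] [Bimodule R S N] [Bimodule R S N']
    {f : M →+ M'} {g : N →+ N'} (hf : IsRightLinear R f) (hg : IsLeftLinear R g)
    (hg' : IsRightLinear S g) : IsRightLinear S (map R f g hf hg) :=
  rightLinear_of_tmul fun m n s => congrArg (tmul R (f m)) (hg' n s)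

/-- The isomorphism `M ⊗_R e` induced by an isomorphism `e` of left `R`-modules. -/
def congrRight (M : Type*) [AddCommGroup M] [RightModule R M] (e : N ≃+ N')
    (he : IsLeftLinear R e.toAddMonoidHom) : Tens R M N ≃+ Tens R M N' :=
  AddMonoidHom.toAddEquiv (map R (.id M) e.toAddMonoidHom (IsRightLinear.id R) he)
    (map R (.id M) e.symm.toAddMonoidHom (IsRightLinear.id R) he.symm)
    (hom_ext R fun m n => congrArg (tmul R m) (e.symm_apply_apply n))
    (hom_ext R fun m n => congrArg (tmul R m) (e.apply_symm_apply n))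

end Tens

end Linearity

section HomExt

variable {R A M N P Q : Type*} [NonUnitalRing R] [NonUnitalRing A] [AddCommGroup M]
  [AddCommGroup N] [AddCommGroup P] [AddCommGroup Q]

theorem Tens.hom_ext_tmul_left [RightModule A M] [LeftModule A N] [RightModule R (Tens A M N)]
    [LeftModule R P] {f g : Tens R (Tens A M N) P →+ Q}
    (h : ∀ m n p, f (tmul R (tmul A m n) p) = g (tmul R (tmul A m n) p)) : f = g :=
  hom_ext R fun x p => DFunLike.congr_fun
    (hom_ext A (f := f.comp ((mk R _ P).flip p)) (g := g.comp ((mk R _ P).flip p)) (h · · p)) x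

end HomExt

section Firm

variable {R A M N P : Type*} [NonUnitalRing R] [NonUnitalRing A] [AddCommGroup M] [AddCommGroup N]
  [AddCommGroup P]

theorem rmulMap_rightLinear [RightModule R M] : IsRightLinear R (rmulMap R M) :=
  Tens.rightLinear_of_tmul fun m r s => RightModule.rsmul_mul m r s

theorem rmulMap_leftLinear [LeftModule A M] [RightModule R M] [Bimodule A R M] :
    IsLeftLinear A (rmulMap R M) :=
  Tens.leftLinear_of_tmul fun a m r => Bimodule.lsmul_rsmul a m r

theorem lmulMap_leftLinear [LeftModule R M] : IsLeftLinear R (lmulMap R M) :=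
  Tens.leftLinear_of_tmul fun r s m => LeftModule.mul_lsmul r s m

theorem lmulMap_rightLinear [LeftModule R M] [RightModule A M] [Bimodule R A M] :
    IsRightLinear A (lmulMap R M) :=
  Tens.rightLinear_of_tmul fun r m a => (Bimodule.lsmul_rsmul r m a).symm

theorem rmulMap_map [RightModule R M] [RightModule R N] {f : M →+ N} (hf : IsRightLinear R f)
    (x : Tens R M R) :
    rmulMap R N (Tens.map R f (.id R) hf (IsLeftLinear.id R) x) = f (rmulMap R M x) :=
  DFunLike.congr_fun (Tens.hom_ext R (f := (rmulMap R N).comp (Tens.map R f (.id R) hf _))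
    (g := f.comp (rmulMap R M)) fun m r => (hf m r).symm) x

theorem Tens.rsmul_eq_rmulMap_tmul [RightModule R M] (x : Tens R M R) (r : R) :
    x •ᵣ r = tmul R (rmulMap R M x) r :=
  DFunLike.congr_fun (hom_ext R (f := (ractHom R (Tens R M R)).flip r)
    (g := ((mk R M R).flip r).comp (rmulMap R M)) fun m s => (rsmul_tmul R m s r).symm) x

namespace Tens

variable [RightModule A M] [LeftModule A N] [RightModule R N] [Bimodule A R N] [LeftModule R P]

theorem map_rmulMap_assocHom (x : Tens R (Tens A M N) R) :
    map A (.id M) (rmulMap R N) (IsRightLinear.id A) rmulMap_leftLinear (assocHom R A M N R x) =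
      rmulMap R (Tens A M N) x :=
  DFunLike.congr_fun (hom_ext_tmul_left
    (f := (map A (.id M) (rmulMap R N) (IsRightLinear.id A) rmulMap_leftLinear).comp
      (assocHom R A M N R))
    (g := rmulMap R (Tens A M N)) fun _ _ _ => rfl) x

theorem assocHom_leftLinear {B : Type*} [NonUnitalRing B] [LeftModule B M] [Bimodule B A M] :
    IsLeftLinear B (assocHom R A M N P) := fun b =>
  DFunLike.congr_fun (hom_ext_tmul_left (f := (assocHom R A M N P).comp (lactHom B _ b))
    (g := (lactHom B _ b).comp (assocHom R A M N P)) fun _ _ _ => rfl)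

theorem assocHom_rightLinear {B : Type*} [NonUnitalRing B] [RightModule B P] [Bimodule R B P] :
    IsRightLinear B (assocHom R A M N P) := fun x b =>
  DFunLike.congr_fun (hom_ext_tmul_left
    (f := (assocHom R A M N P).comp ((ractHom B _).flip b))
    (g := ((ractHom B (Tens A M (Tens R N P))).flip b).comp (assocHom R A M N P))
    fun _ _ _ => rfl) x

end Tens

namespace IsRightFirm

/-- The multiplication isomorphism `M ⊗_R R ≅ M` of a firm right module. -/
noncomputable def mulEquiv [RightModule R M] (h : IsRightFirm R M) : Tens R M R ≃+ M :=
  AddEquiv.ofBijective (rmulMap R M) h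

theorem mulEquiv_symm_rsmul [RightModule R M] (h : IsRightFirm R M) (m : M) (r : R) :
    h.mulEquiv.symm (m •ᵣ r) = Tens.tmul R m r :=
  h.mulEquiv.symm_apply_apply (Tens.tmul R m r)

theorem mulEquiv_symm_rightLinear [RightModule R M] (h : IsRightFirm R M) :
    IsRightLinear R h.mulEquiv.symm.toAddMonoidHom :=
  IsRightLinear.symm (e := h.mulEquiv) rmulMap_rightLinear

theorem mulEquiv_symm_leftLinear [LeftModule A M] [RightModule R M] [Bimodule A R M]
    (h : IsRightFirm R M) : IsLeftLinear A h.mulEquiv.symm.toAddMonoidHom :=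
  IsLeftLinear.symm (e := h.mulEquiv) rmulMap_leftLinear

theorem hom_ext [RightModule R M] (h : IsRightFirm R M) {f g : M →+ P}
    (hfg : ∀ m (r : R), f (m •ᵣ r) = g (m •ᵣ r)) : f = g :=
  (AddMonoidHom.cancel_right h.2).1 (Tens.hom_ext R hfg)

theorem hom_ext_tens_left [RightModule R M] [LeftModule R N] (h : IsRightFirm R M)
    {f g : Tens R M N →+ P}
    (hfg : ∀ m (r : R) n, f (Tens.tmul R (m •ᵣ r) n) = g (Tens.tmul R (m •ᵣ r) n)) : f = g :=
  Tens.hom_ext R fun m n => DFunLike.congr_fun (h.hom_ext (f := f.comp ((Tens.mk R M N).flip n))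
    (g := g.comp ((Tens.mk R M N).flip n)) (hfg · · n)) m

theorem hom_ext_tens_right [RightModule A M] [LeftModule A N] [RightModule R N]
    (h : IsRightFirm R N) {f g : Tens A M N →+ P}
    (hfg : ∀ m n (r : R), f (Tens.tmul A m (n •ᵣ r)) = g (Tens.tmul A m (n •ᵣ r))) : f = g :=
  Tens.hom_ext A fun m => DFunLike.congr_fun (h.hom_ext (f := f.comp (Tens.mk A M N m))
    (g := g.comp (Tens.mk A M N m)) (hfg m))

theorem of_section [RightModule R M] (σ : M →+ Tens R M R) (hσ : ∀ m, rmulMap R M (σ m) = m)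
    (hσ' : ∀ m (r : R), σ (m •ᵣ r) = Tens.tmul R m r) : IsRightFirm R M :=
  Function.bijective_iff_has_inverse.2 ⟨σ, DFunLike.congr_fun
    (Tens.hom_ext R (f := σ.comp (rmulMap R M)) (g := .id _) hσ'), hσ⟩

end IsRightFirm

namespace IsLeftFirm

/-- The multiplication isomorphism `R ⊗_R M ≅ M` of a firm left module. -/
noncomputable def mulEquiv [LeftModule R M] (h : IsLeftFirm R M) : Tens R R M ≃+ M :=
  AddEquiv.ofBijective (lmulMap R M) h

theorem hom_ext [LeftModule R M] (h : IsLeftFirm R M) {f g : M →+ P}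
    (hfg : ∀ (r : R) m, f (r •ₗ m) = g (r •ₗ m)) : f = g :=
  (AddMonoidHom.cancel_right h.2).1 (Tens.hom_ext R hfg)

theorem of_section [LeftModule R M] (σ : M →+ Tens R R M) (hσ : ∀ m, lmulMap R M (σ m) = m)
    (hσ' : ∀ (r : R) m, σ (r •ₗ m) = Tens.tmul R r m) : IsLeftFirm R M :=
  Function.bijective_iff_has_inverse.2 ⟨σ, DFunLike.congr_fun
    (Tens.hom_ext R (f := σ.comp (lmulMap R M)) (g := .id _) hσ'), hσ⟩

end IsLeftFirm

end Firm

namespace Dual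

variable {R A S T : Type*} [NonUnitalRing R] [NonUnitalRing A] [AddCommGroup S] [AddCommGroup T]
  [RightModule A S]

theorem ext {φ ψ : Dual A S} (h : ∀ u, φ.1 u = ψ.1 u) : φ = ψ :=
  Subtype.ext (AddMonoidHom.ext h)

section Contract

variable [LeftModule A T] (T)

/-- The map `φ ⊗_A T : S ⊗_A T → A ⊗_A T` for `φ ∈ S*`, as an additive function of `φ`. -/
def rTensor : Dual A S →+ Tens A S T →+ Tens A A T :=
  AddMonoidHom.mk' (fun φ => Tens.map A φ.1 (.id T) φ.2 (IsLeftLinear.id A))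
    fun φ ψ => Tens.hom_ext A fun u => Tens.add_tmul A (φ.1 u) (ψ.1 u)

/-- The contraction `S ⊗_A T → T`, `u ⊗ t ↦ φ(u) t`, with `φ ∈ S*`. -/
def contract : Dual A S →+ Tens A S T →+ T :=
  (AddMonoidHom.compHom (lmulMap A T)).comp (rTensor T)

variable {T}

theorem rTensor_lsmul (a : A) (φ : Dual A S) (x : Tens A S T) :
    rTensor T (a •ₗ φ) x = Tens.tmul A a (contract T φ x) :=
  DFunLike.congr_fun (Tens.hom_ext A (f := rTensor T (a •ₗ φ))
    (g := (Tens.mk A A T a).comp (contract T φ)) fun u t => Tens.rsmul_tmul A a (φ.1 u) t) x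

theorem contract_lsmul (a : A) (φ : Dual A S) (x : Tens A S T) :
    contract T (a •ₗ φ) x = a •ₗ contract T φ x :=
  congrArg (lmulMap A T) (rTensor_lsmul a φ x)

theorem rTensor_rsmul [LeftModule R S] [Bimodule R A S] (φ : Dual A S) (r : R) (x : Tens A S T) :
    rTensor T (φ •ᵣ r) x = rTensor T φ (r •ₗ x) :=
  DFunLike.congr_fun (Tens.hom_ext A (f := rTensor T (φ •ᵣ r))
    (g := (rTensor T φ).comp (lactHom R _ r)) fun _ _ => rfl) x

theorem contract_rsmul [LeftModule R S] [Bimodule R A S] (φ : Dual A S) (r : R)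
    (x : Tens A S T) : contract T (φ •ᵣ r) x = contract T φ (r •ₗ x) :=
  congrArg (lmulMap A T) (rTensor_rsmul φ r x)

theorem contract_rightLinear [RightModule R T] [Bimodule A R T] (φ : Dual A S) :
    IsRightLinear R (contract T φ) :=
  Tens.rightLinear_of_tmul fun u t r => (Bimodule.lsmul_rsmul (φ.1 u) t r).symm

theorem contract_map {T' : Type*} [AddCommGroup T'] [LeftModule A T'] {f : T →+ T'}
    (hf : IsLeftLinear A f) (φ : Dual A S) (x : Tens A S T) :
    contract T' φ (Tens.map A (.id S) f (IsRightLinear.id A) hf x) = f (contract T φ x) :=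
  DFunLike.congr_fun (Tens.hom_ext A (f := (contract T' φ).comp (Tens.map A (.id S) f _ hf))
    (g := f.comp (contract T φ)) fun u t => (hf (φ.1 u) t).symm) x

theorem contract_apply (φ : Dual A S) (x : ElementaryRing A S) (v : S) :
    (contract (Dual A S) φ x).1 v = φ.1 (ElementaryRing.act A S x v) :=
  DFunLike.congr_fun (Tens.hom_ext A
    (f := (AddMonoidHom.eval v).comp ((Dual A S).subtype.comp (contract (Dual A S) φ)))
    (g := (φ.1.comp ((ElementaryRing.act A S).flip v) : Tens A S (Dual A S) →+ A))
    fun u ψ => (φ.2 u (ψ.1 v)).symm) x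

theorem contract_assocHom [RightModule R T] [Bimodule A R T] {P : Type*} [AddCommGroup P]
    [LeftModule R P] (φ : Dual A S) (x : Tens A S T) (p : P) :
    contract (Tens R T P) φ (Tens.assocHom R A S T P (Tens.tmul R x p)) =
      Tens.tmul R (contract T φ x) p :=
  DFunLike.congr_fun (Tens.hom_ext A
    (f := (contract (Tens R T P) φ).comp ((Tens.assocHom R A S T P).comp ((Tens.mk R _ P).flip p)))
    (g := ((Tens.mk R T P).flip p).comp (contract T φ)) fun _ _ => rfl) x

end Contract

section Pairing

variable [LeftModule R S] [Bimodule R A S] [RightModule R T]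

/-- The pairing `T ⊗_R S → A`, `t ⊗ u ↦ (j t)(u)`, of a right linear map `j : T → S*`. -/
def pairing (j : T →+ Dual A S) (hj : IsRightLinear R j) : Tens R T S →+ A :=
  Tens.lift R ((Dual A S).subtype.comp j)
    fun t r u => DFunLike.congr_fun (congrArg Subtype.val (hj t r)) u

/-- The map `T → S*`, `t ↦ ε(t ⊗ -)`, of a pairing `ε : T ⊗_R S → A`. -/
def ofPairing (ε : Tens R T S →+ A) (hε : IsRightLinear A ε) : T →+ Dual A S :=
  ((AddMonoidHom.compHom ε).comp (Tens.mk R T S)).codRestrict (Dual A S)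
    fun t u => hε (Tens.tmul R t u)

theorem ofPairing_bilinear [LeftModule A T] [Bimodule A R T] {ε : Tens R T S →+ A}
    (hε : IsBilinear A A ε) : IsBilinear A R (ofPairing ε hε.2) :=
  ⟨fun a t => ext fun u => hε.1 a (Tens.tmul R t u),
    fun t r => ext fun u => congrArg ε (Tens.rsmul_tmul R t r u)⟩

theorem pairing_bilinear [LeftModule A T] [Bimodule A R T] {j : T →+ Dual A S}
    (hj : IsBilinear A R j) : IsBilinear A A (pairing j hj.2) :=
  ⟨Tens.leftLinear_of_tmul fun a t u =>
      DFunLike.congr_fun (congrArg Subtype.val (hj.1 a t)) u,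
    Tens.rightLinear_of_tmul fun t u a => (j t).2 u a⟩

end Pairing

end Dual

section FirmlyProjective

variable {R A S : Type*} [NonUnitalRing R] [NonUnitalRing A] [AddCommGroup S] [LeftModule R S]
  [RightModule A S] [Bimodule R A S]

namespace ElementaryRing

theorem act_lsmul (r : R) (x : Tens A S (Dual A S)) (v : S) :
    act A S (r •ₗ x : Tens A S (Dual A S)) v = r •ₗ act A S x v :=
  DFunLike.congr_fun (Tens.hom_ext A
    (f := ((act A S).flip v : Tens A S (Dual A S) →+ S).comp (lactHom R (Tens A S (Dual A S)) r))
    (g := (lactHom R S r).comp ((act A S).flip v : Tens A S (Dual A S) →+ S))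
    fun u φ => Bimodule.lsmul_rsmul r u (φ.1 v)) x

theorem mulLeft_tmul_eq_contract (u : S) (φ : Dual A S) (x : ElementaryRing A S) :
    mulLeft A S (tmul u φ) x = Tens.tmul A u (Dual.contract (Dual A S) φ x) :=
  DFunLike.congr_fun (Tens.hom_ext A
    (f := (mulLeft A S (tmul u φ) : Tens A S (Dual A S) →+ Tens A S (Dual A S)))
    (g := (Tens.mk A S (Dual A S) u).comp (Dual.contract (Dual A S) φ))
    fun v ψ => Tens.rsmul_tmul A u (φ.1 v) ψ) x

variable {z : ElementaryRing A S} {r : R}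

theorem mulLeft_eq_lsmul (hz : ∀ u, act A S z u = r •ₗ u) (x : Tens A S (Dual A S)) :
    mulLeft A S z x = r •ₗ x :=
  DFunLike.congr_fun (Tens.hom_ext A
    (f := (mulLeft A S z : Tens A S (Dual A S) →+ Tens A S (Dual A S)))
    (g := lactHom R (Tens A S (Dual A S)) r) fun u φ => congrArg (Tens.tmul A · φ) (hz u)) x

theorem contract_eq_rsmul (hz : ∀ u, act A S z u = r •ₗ u) (φ : Dual A S) :
    Dual.contract (Dual A S) φ z = φ •ᵣ r :=
  Dual.ext fun u => (Dual.contract_apply φ z u).trans (congrArg φ.1 (hz u))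

theorem mulLeft_eq_rsmul (hz : ∀ u, act A S z u = r •ₗ u) (x : Tens A S (Dual A S)) :
    mulLeft A S x z = x •ᵣ r :=
  DFunLike.congr_fun (Tens.hom_ext A
    (f := (AddMonoidHom.mulRight z : ElementaryRing A S →+ ElementaryRing A S))
    (g := (ractHom R (Tens A S (Dual A S))).flip r) fun u φ =>
      (mulLeft_tmul_eq_contract u φ z).trans (congrArg (Tens.tmul A u) (contract_eq_rsmul hz φ))) x

end ElementaryRing

theorem isFirmlyProjective_iff :
    IsFirmlyProjective A S R ↔ IsLeftFirm R S ∧ ∃ f : R →+ Tens A S (Dual A S),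
      IsBilinear R R f ∧ ∀ r u, ElementaryRing.act A S (f r) u = r •ₗ u := by
  constructor
  · rintro ⟨ι, hι, hS⟩
    have hact (r : R) (u : S) : ElementaryRing.act A S (ι r) u = r •ₗ u := (hι r u).symm
    exact ⟨hS, (ι : R →+ ElementaryRing A S),
      ⟨fun r s => (map_mul ι r s).trans (ElementaryRing.mulLeft_eq_lsmul (hact r) (ι s)),
        fun s r => (map_mul ι s r).trans (ElementaryRing.mulLeft_eq_rsmul (hact r) (ι s))⟩, hact⟩
  · rintro ⟨hS, f, hf, hact⟩
    let ι : R →ₙ+* ElementaryRing A S :=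
      { (f : R →+ ElementaryRing A S) with
        map_mul' := fun r s =>
          (hf.1 r s).trans (ElementaryRing.mulLeft_eq_lsmul (hact r) (f s)).symm }
    exact ⟨ι, fun r u => (hact r u).symm, hS⟩

end FirmlyProjective

section CoringPair

variable {R A S T T' : Type*} [NonUnitalRing R] [NonUnitalRing A] [AddCommGroup S]
  [AddCommGroup T] [AddCommGroup T'] [LeftModule R S] [RightModule A S] [Bimodule R A S]
  [LeftModule A T] [RightModule R T] [Bimodule A R T]
  [LeftModule A T'] [RightModule R T'] [Bimodule A R T']

/-- The data `(η, ε)` of a comatrix coring context between bimodules `S` and `T`, with the pairing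
`ε : T ⊗_R S → A` replaced by its adjoint `j : T → S*`, `t ↦ ε(t ⊗ -)`. In this form the two
commutative diagrams say that `η r` behaves like a dual basis, up to multiplication by `r`. -/
structure IsCoringPair (η : R →+ Tens A S T) (j : T →+ Dual A S) : Prop where
  η_bilinear : IsBilinear R R η
  j_bilinear : IsBilinear A R j
  act_η : ∀ r u, ElementaryRing.act A S
    (Tens.map A (.id S) j (IsRightLinear.id A) j_bilinear.1 (η r)) u = r •ₗ u
  contract_η : ∀ t r, Dual.contract T (j t) (η r) = t •ᵣ r

theorem rmulMap_map_assocHom (ε : Tens R T S →+ A) (hε : IsBilinear A A ε) (x : Tens A S T)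
    (u : S) :
    rmulMap A S (Tens.map A (.id S) ε (IsRightLinear.id A) hε.1
      (Tens.assocHom R A S T S (Tens.tmul R x u))) =
    ElementaryRing.act A S (Tens.map A (.id S) (Dual.ofPairing ε hε.2) (IsRightLinear.id A)
      (Dual.ofPairing_bilinear hε).1 x) u :=
  DFunLike.congr_fun (Tens.hom_ext A
    (f := (((rmulMap A S).comp (Tens.map A (.id S) ε (IsRightLinear.id A) hε.1)).comp
      (Tens.assocHom R A S T S)).comp ((Tens.mk R (Tens A S T) S).flip u))
    (g := ((ElementaryRing.act A S).flip u : Tens A S (Dual A S) →+ S).comp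
      (Tens.map A (.id S) (Dual.ofPairing ε hε.2) (IsRightLinear.id A)
        (Dual.ofPairing_bilinear hε).1))
    fun _ _ => rfl) x

theorem lmulMap_map_assocInv (ε : Tens R T S →+ A) (hε : IsBilinear A A ε) (t : T)
    (x : Tens A S T) :
    lmulMap A T (Tens.map A ε (.id T) hε.2 (IsLeftLinear.id A)
      (Tens.assocInv A R T S T (Tens.tmul R t x))) =
    Dual.contract T (Dual.ofPairing ε hε.2 t) x :=
  DFunLike.congr_fun (Tens.hom_ext A
    (f := (((lmulMap A T).comp (Tens.map A ε (.id T) hε.2 (IsLeftLinear.id A))).comp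
      (Tens.assocInv A R T S T)).comp (Tens.mk R T (Tens A S T) t))
    (g := Dual.contract T (Dual.ofPairing ε hε.2 t)) fun _ _ => rfl) x

namespace IsCoringPair

variable {η : R →+ Tens A S T} {j : T →+ Dual A S}

theorem isFirmlyProjective (h : IsCoringPair η j) (hS : IsLeftFirm R S) :
    IsFirmlyProjective A S R :=
  isFirmlyProjective_iff.2 ⟨hS,
    (Tens.map A (.id S) j (IsRightLinear.id A) h.j_bilinear.1).comp η,
    ⟨(Tens.map_leftLinear (IsRightLinear.id A) h.j_bilinear.1 (IsLeftLinear.id R)).comp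
        h.η_bilinear.1,
      (Tens.map_rightLinear (IsRightLinear.id A) h.j_bilinear.1 h.j_bilinear.2).comp
        h.η_bilinear.2⟩,
    h.act_η⟩

theorem apply_contract (h : IsCoringPair η j) (φ : Dual A S) (r : R) :
    j (Dual.contract T φ (η r)) = φ •ᵣ r :=
  (Dual.contract_map h.j_bilinear.1 φ (η r)).symm.trans
    (ElementaryRing.contract_eq_rsmul (h.act_η r) φ)

/-- The map `S* ⊗_R R → T`, `φ ⊗ r ↦ φ(η r)`. -/
def fromDual (h : IsCoringPair η j) : Tens R (Dual A S) R →+ T :=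
  Tens.lift R ((Dual.contract T).compl₂ η) fun φ r s =>
    (Dual.contract_rsmul φ r (η s)).trans (congrArg (Dual.contract T φ) (h.η_bilinear.1 r s).symm)

theorem fromDual_rightLinear (h : IsCoringPair η j) : IsRightLinear R h.fromDual :=
  Tens.rightLinear_of_tmul fun φ r s =>
    (congrArg (Dual.contract T φ) (h.η_bilinear.2 r s)).trans (Dual.contract_rightLinear φ (η r) s)

theorem bimoduleIso (h : IsCoringPair η j) (hR : IsFirmRing R) (hT : IsRightFirm R T) :
    BimoduleIso A R T (Tens R (Dual A S) R) := by
  let toDual : T →+ Tens R (Dual A S) R :=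
    (Tens.map R j (.id R) h.j_bilinear.2 (IsLeftLinear.id R)).comp hT.mulEquiv.symm.toAddMonoidHom
  have toDual_rsmul (t : T) (r : R) : toDual (t •ᵣ r) = Tens.tmul R (j t) r :=
    congrArg (Tens.map R j (.id R) h.j_bilinear.2 (IsLeftLinear.id R))
      (hT.mulEquiv_symm_rsmul t r)
  have from_to : h.fromDual.comp toDual = .id T := hT.hom_ext fun t r =>
    (congrArg h.fromDual (toDual_rsmul t r)).trans (h.contract_η t r)
  have to_from_tmul (φ : Dual A S) (r s : R) :
      toDual (h.fromDual (Tens.tmul R φ r •ᵣ s)) = Tens.tmul R φ r •ᵣ s := calc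
    _ = toDual (Dual.contract T φ (η r) •ᵣ s) := congrArg toDual (h.fromDual_rightLinear _ s)
    _ = Tens.tmul R (φ •ᵣ r) s := by rw [toDual_rsmul, h.apply_contract]
    _ = _ := Tens.rsmul_tmul R φ r s
  have to_from : toDual.comp h.fromDual = .id _ :=
    (hR.tens R R (Dual A S) R).hom_ext fun x s => DFunLike.congr_fun (Tens.hom_ext R
      (f := (toDual.comp h.fromDual).comp ((ractHom R _).flip s))
      (g := (ractHom R (Tens R (Dual A S) R)).flip s)
      fun φ r => to_from_tmul φ r s) x
  exact ⟨toDual.toAddEquiv h.fromDual from_to to_from,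
    (Tens.map_leftLinear h.j_bilinear.2 (IsLeftLinear.id R) h.j_bilinear.1).comp
      hT.mulEquiv_symm_leftLinear,
    (Tens.map_rightLinear h.j_bilinear.2 (IsLeftLinear.id R) (IsRightLinear.id R)).comp
      hT.mulEquiv_symm_rightLinear⟩

theorem isLeftFirm (h : IsCoringPair η j) (hT : IsRightFirm R T) : IsLeftFirm A T := by
  let β : Tens R T R →+ Tens A A T :=
    Tens.lift R (((Dual.rTensor T).comp j).compl₂ η) fun t r s => calc
      Dual.rTensor T (j (t •ᵣ r)) (η s) = Dual.rTensor T (j t •ᵣ r) (η s) := by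
        rw [h.j_bilinear.2]
      _ = Dual.rTensor T (j t) (r •ₗ η s) := Dual.rTensor_rsmul (j t) r (η s)
      _ = Dual.rTensor T (j t) (η (r •ₗ s)) := by rw [h.η_bilinear.1]
  let σ : T →+ Tens A A T := β.comp hT.mulEquiv.symm.toAddMonoidHom
  have σ_rsmul (t : T) (r : R) : σ (t •ᵣ r) = Dual.rTensor T (j t) (η r) :=
    congrArg β (hT.mulEquiv_symm_rsmul t r)
  refine IsLeftFirm.of_section σ (DFunLike.congr_fun (hT.hom_ext (g := .id T)
    (f := (lmulMap A T).comp σ) fun t r =>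
      (congrArg (lmulMap A T) (σ_rsmul t r)).trans (h.contract_η t r))) fun a =>
    DFunLike.congr_fun (hT.hom_ext (f := σ.comp (lactHom A T a)) (g := Tens.mk A A T a)
      fun t r => ?_)
  calc
    σ (a •ₗ (t •ᵣ r)) = σ ((a •ₗ t) •ᵣ r) := by rw [Bimodule.lsmul_rsmul]
    _ = Dual.rTensor T (a •ₗ j t) (η r) := by rw [σ_rsmul, h.j_bilinear.1]
    _ = Tens.tmul A a (t •ᵣ r) := by rw [Dual.rTensor_lsmul, h.contract_η]

theorem congr (h : IsCoringPair η j) (e : T' ≃+ T) (he : IsBilinear A R e.toAddMonoidHom) :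
    IsCoringPair ((Tens.congrRight S e he.1).symm.toAddMonoidHom.comp η)
      (j.comp e.toAddMonoidHom) where
  η_bilinear :=
    ⟨(Tens.map_leftLinear (IsRightLinear.id A) he.1.symm (IsLeftLinear.id R)).comp
        h.η_bilinear.1,
      (Tens.map_rightLinear (IsRightLinear.id A) he.1.symm he.2.symm).comp h.η_bilinear.2⟩
  j_bilinear := ⟨h.j_bilinear.1.comp he.1, h.j_bilinear.2.comp he.2⟩
  act_η r u := by
    have cancel : (Tens.map A (.id S) (j.comp e.toAddMonoidHom) (IsRightLinear.id A)
        (h.j_bilinear.1.comp he.1)).comp (Tens.congrRight S e he.1).symm.toAddMonoidHom =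
        Tens.map A (.id S) j (IsRightLinear.id A) h.j_bilinear.1 :=
      Tens.hom_ext A fun v t => congrArg (fun t => Tens.tmul A v (j t)) (e.apply_symm_apply t)
    exact (congrArg (ElementaryRing.act A S · u) (DFunLike.congr_fun cancel (η r))).trans
      (h.act_η r u)
  contract_η t r := calc
    _ = e.symm (Dual.contract T (j (e t)) (η r)) := Dual.contract_map he.1.symm (j (e t)) (η r)
    _ = e.symm (e t •ᵣ r) := congrArg e.symm (h.contract_η (e t) r)
    _ = t •ᵣ r := e.symm_apply_eq.2 (he.2 t r).symm

end IsCoringPair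

end CoringPair

namespace IsFirmRing

variable {R A M N : Type*} [NonUnitalRing R] [NonUnitalRing A] [AddCommGroup M] [AddCommGroup N]
  [RightModule A M] [LeftModule A N] [RightModule R N] [Bimodule A R N] {f : R →+ Tens A M N}

/-- The lift of a right linear map `R → M ⊗_A N` along `M ⊗_A (N ⊗_R R) → M ⊗_A N`. -/
noncomputable def liftTens (hR : IsFirmRing R) (f : R →+ Tens A M N) (hf : IsRightLinear R f) :
    R →+ Tens A M (Tens R N R) :=
  (Tens.assocHom R A M N R).comp
    ((Tens.map R f (.id R) hf (IsLeftLinear.id R)).comp hR.mulEquiv.symm.toAddMonoidHom)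

theorem liftTens_rsmul (hR : IsFirmRing R) (hf : IsRightLinear R f) (r s : R) :
    hR.liftTens f hf (r •ᵣ s) = Tens.assocHom R A M N R (Tens.tmul R (f r) s) :=
  congrArg (fun x => Tens.assocHom R A M N R (Tens.map R f (.id R) hf (IsLeftLinear.id R) x))
    (hR.mulEquiv_symm_rsmul r s)

theorem liftTens_bilinear [LeftModule R M] [Bimodule R A M] (hR : IsFirmRing R)
    (hf : IsBilinear R R f) : IsBilinear R R (hR.liftTens f hf.2) :=
  ⟨Tens.assocHom_leftLinear.comp ((Tens.map_leftLinear hf.2 (IsLeftLinear.id R) hf.1).comp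
      hR.mulEquiv_symm_leftLinear),
    Tens.assocHom_rightLinear.comp ((Tens.map_rightLinear hf.2 (IsLeftLinear.id R)
      (IsRightLinear.id R)).comp hR.mulEquiv_symm_rightLinear)⟩

theorem map_rmulMap_liftTens (hR : IsFirmRing R) (hf : IsRightLinear R f) (r : R) :
    Tens.map A (.id M) (rmulMap R N) (IsRightLinear.id A) rmulMap_leftLinear
      (hR.liftTens f hf r) = f r := calc
  _ = rmulMap R (Tens A M N) (Tens.map R f (.id R) hf (IsLeftLinear.id R)
        (hR.mulEquiv.symm r)) := Tens.map_rmulMap_assocHom _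
  _ = f (rmulMap R R (hR.mulEquiv.symm r)) := rmulMap_map hf _
  _ = f r := congrArg f (hR.mulEquiv.apply_symm_apply r)

end IsFirmRing

theorem exists_isCoringPair {R A S : Type*} [NonUnitalRing R] [NonUnitalRing A] [AddCommGroup S]
    [LeftModule R S] [RightModule A S] [Bimodule R A S] (hR : IsFirmRing R)
    (h : IsFirmlyProjective A S R) :
    ∃ η : R →+ Tens A S (Tens R (Dual A S) R), IsCoringPair η (rmulMap R (Dual A S)) := by
  obtain ⟨-, f, hf, hact⟩ := isFirmlyProjective_iff.1 h
  let η : R →+ Tens A S (Tens R (Dual A S) R) := hR.liftTens f hf.2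
  have η_bilinear : IsBilinear R R η := hR.liftTens_bilinear hf
  have contract_η (φ : Dual A S) (r : R) :
      Dual.contract (Tens R (Dual A S) R) φ (η r) = Tens.tmul R φ r := by
    refine DFunLike.congr_fun (hR.hom_ext (f := (Dual.contract _ φ).comp η)
      (g := Tens.mk R (Dual A S) R φ) fun r s => ?_) r
    calc
      Dual.contract _ φ (η (r •ᵣ s)) = Tens.tmul R (Dual.contract _ φ (f r)) s := by
        rw [hR.liftTens_rsmul, Dual.contract_assocHom]
      _ = Tens.tmul R (φ •ᵣ r) s :=
        congrArg (Tens.tmul R · s) (ElementaryRing.contract_eq_rsmul (hact r) φ)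
      _ = Tens.tmul R φ (r •ᵣ s) := Tens.rsmul_tmul R φ r s
  refine ⟨η, η_bilinear, ⟨rmulMap_leftLinear, rmulMap_rightLinear⟩, fun r u => ?_, fun x r => ?_⟩
  · exact (congrArg (ElementaryRing.act A S · u) (hR.map_rmulMap_liftTens hf.2 r)).trans (hact r u)
  refine DFunLike.congr_fun (Tens.hom_ext R (g := (ractHom R (Tens R (Dual A S) R)).flip r)
    (f := ((Dual.contract (Tens R (Dual A S) R)).flip (η r)).comp (rmulMap R (Dual A S)))
    fun φ s => ?_) x
  calc
    Dual.contract _ (φ •ᵣ s) (η r) = Dual.contract _ φ (η (s •ₗ r)) := by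
      rw [Dual.contract_rsmul, η_bilinear.1]
    _ = Tens.tmul R φ (s •ₗ r) := contract_η φ _

section UnitCounit

variable {R A M N S T : Type*} [NonUnitalRing R] [NonUnitalRing A] [AddCommGroup M]
  [AddCommGroup N] [AddCommGroup S] [AddCommGroup T] [RightModule R M] [RightModule A N]
  [LeftModule R S] [RightModule A S] [Bimodule R A S] [LeftModule A T]

/-- The unit `M → (M ⊗_R S) ⊗_A T`, `m r ↦ m ⊗ η r`, of a firm right module `M`. -/
noncomputable def unitMap (hM : IsRightFirm R M) (η : R →+ Tens A S T) (hη : IsLeftLinear R η) :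
    M →+ Tens A (Tens R M S) T :=
  (Tens.assocInv A R M S T).comp
    ((Tens.map R (.id M) η (IsRightLinear.id R) hη).comp hM.mulEquiv.symm.toAddMonoidHom)

theorem unitMap_rsmul (hM : IsRightFirm R M) {η : R →+ Tens A S T} (hη : IsLeftLinear R η)
    (m : M) (r : R) :
    unitMap hM η hη (m •ᵣ r) = Tens.assocInv A R M S T (Tens.tmul R m (η r)) :=
  congrArg (fun x => Tens.assocInv A R M S T (Tens.map R (.id M) η (IsRightLinear.id R) hη x))
    (hM.mulEquiv_symm_rsmul m r)

theorem unitMap_naturality {M' : Type*} [AddCommGroup M'] [RightModule R M']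
    (hM : IsRightFirm R M) (hM' : IsRightFirm R M') {η : R →+ Tens A S T}
    (hη : IsLeftLinear R η) {f : M →+ M'} (hf : IsRightLinear R f) :
    (unitMap hM' η hη).comp f =
      (Tens.map A (Tens.map R f (.id S) hf (IsLeftLinear.id R)) (.id T)
        (Tens.map_rightLinear hf (IsLeftLinear.id R) (IsRightLinear.id A))
        (IsLeftLinear.id A)).comp (unitMap hM η hη) := by
  refine hM.hom_ext fun m r => ?_
  have natural (x : Tens A S T) : Tens.assocInv A R M' S T (Tens.tmul R (f m) x) =
      Tens.map A (Tens.map R f (.id S) hf (IsLeftLinear.id R)) (.id T)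
        (Tens.map_rightLinear hf (IsLeftLinear.id R) (IsRightLinear.id A)) (IsLeftLinear.id A)
        (Tens.assocInv A R M S T (Tens.tmul R m x)) :=
    DFunLike.congr_fun (Tens.hom_ext A
      (f := (Tens.assocInv A R M' S T).comp (Tens.mk R M' (Tens A S T) (f m)))
      (g := (Tens.map A (Tens.map R f (.id S) hf (IsLeftLinear.id R)) (.id T)
        (Tens.map_rightLinear hf (IsLeftLinear.id R) (IsRightLinear.id A))
        (IsLeftLinear.id A)).comp ((Tens.assocInv A R M S T).comp (Tens.mk R M (Tens A S T) m)))
      fun _ _ => rfl) x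
  rw [AddMonoidHom.comp_apply, AddMonoidHom.comp_apply, hf, unitMap_rsmul, unitMap_rsmul, natural]

variable [RightModule R T] [Bimodule A R T]

theorem unitMap_rightLinear (hM : IsRightFirm R M) {η : R →+ Tens A S T} (hη : IsBilinear R R η) :
    IsRightLinear R (unitMap hM η hη.1) :=
  (IsRightLinear.symm (e := Tens.assoc A R M S T) Tens.assocHom_rightLinear).comp
    ((Tens.map_rightLinear (IsRightLinear.id R) hη.1 hη.2).comp hM.mulEquiv_symm_rightLinear)

variable (N) in
/-- The counit `(N ⊗_A T) ⊗_R S → N`, `(n ⊗ t) ⊗ u ↦ n (j t)(u)`. -/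
def counitMap (j : T →+ Dual A S) (hj : IsBilinear A R j) : Tens R (Tens A N T) S →+ N :=
  (rmulMap A N).comp ((Tens.map A (.id N) (Dual.pairing j hj.2) (IsRightLinear.id A)
    (Dual.pairing_bilinear hj).1).comp (Tens.assocHom R A N T S))

theorem counitMap_rightLinear {j : T →+ Dual A S} (hj : IsBilinear A R j) :
    IsRightLinear A (counitMap N j hj) :=
  rmulMap_rightLinear.comp ((Tens.map_rightLinear (IsRightLinear.id A)
    (Dual.pairing_bilinear hj).1 (Dual.pairing_bilinear hj).2).comp Tens.assocHom_rightLinear)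

theorem counitMap_assocInv {j : T →+ Dual A S} (hj : IsBilinear A R j) (m : M) (x : Tens A S T)
    (u : S) :
    counitMap (Tens R M S) j hj (Tens.tmul R (Tens.assocInv A R M S T (Tens.tmul R m x)) u) =
      Tens.tmul R m (ElementaryRing.act A S
        (Tens.map A (.id S) j (IsRightLinear.id A) hj.1 x) u) :=
  DFunLike.congr_fun (Tens.hom_ext A
    (f := (counitMap (Tens R M S) j hj).comp (((Tens.mk R (Tens A (Tens R M S) T) S).flip u).comp
      ((Tens.assocInv A R M S T).comp (Tens.mk R M (Tens A S T) m))))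
    (g := (Tens.mk R M S m).comp (((ElementaryRing.act A S).flip u : Tens A S (Dual A S) →+ S).comp
      (Tens.map A (.id S) j (IsRightLinear.id A) hj.1))) fun _ _ => rfl) x

theorem map_counitMap_assocInv {j : T →+ Dual A S} (hj : IsBilinear A R j) (n : N) (t : T)
    (x : Tens A S T) :
    Tens.map A (counitMap N j hj) (.id T) (counitMap_rightLinear hj) (IsLeftLinear.id A)
      (Tens.assocInv A R (Tens A N T) S T (Tens.tmul R (Tens.tmul A n t) x)) =
    Tens.tmul A n (Dual.contract T (j t) x) :=
  DFunLike.congr_fun (Tens.hom_ext A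
    (f := (Tens.map A (counitMap N j hj) (.id T) (counitMap_rightLinear hj)
      (IsLeftLinear.id A)).comp ((Tens.assocInv A R (Tens A N T) S T).comp
        (Tens.mk R (Tens A N T) (Tens A S T) (Tens.tmul A n t))))
    (g := (Tens.mk A N T n).comp (Dual.contract T (j t)))
    fun v t' => Tens.rsmul_tmul A n ((j t).1 v) t') x

theorem counitMap_naturality {N' : Type*} [AddCommGroup N'] [RightModule A N']
    {j : T →+ Dual A S} (hj : IsBilinear A R j) {f : N →+ N'} (hf : IsRightLinear A f) :
    (counitMap N' j hj).comp (Tens.map R (Tens.map A f (.id T) hf (IsLeftLinear.id A)) (.id S)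
      (Tens.map_rightLinear hf (IsLeftLinear.id A) (IsRightLinear.id R)) (IsLeftLinear.id R)) =
    f.comp (counitMap N j hj) :=
  Tens.hom_ext_tmul_left fun n t u => (hf n ((j t).1 u)).symm

variable {η : R →+ Tens A S T} {j : T →+ Dual A S}

theorem IsCoringPair.counitMap_unitMap (h : IsCoringPair η j) (hM : IsRightFirm R M) :
    (counitMap (Tens R M S) j h.j_bilinear).comp
      (Tens.map R (unitMap hM η h.η_bilinear.1) (.id S) (unitMap_rightLinear hM h.η_bilinear)
        (IsLeftLinear.id R)) = .id (Tens R M S) := by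
  refine hM.hom_ext_tens_left fun m r u => ?_
  rw [AddMonoidHom.comp_apply, Tens.map_tmul, unitMap_rsmul, AddMonoidHom.id_apply,
    counitMap_assocInv, h.act_η, ← Tens.rsmul_tmul, AddMonoidHom.id_apply]

theorem IsCoringPair.map_counitMap_unitMap (h : IsCoringPair η j) (hT : IsRightFirm R T) :
    (Tens.map A (counitMap N j h.j_bilinear) (.id T) (counitMap_rightLinear h.j_bilinear)
      (IsLeftLinear.id A)).comp (unitMap (hT.tens A R N T) η h.η_bilinear.1) =
    .id (Tens A N T) := by
  refine hT.hom_ext_tens_right fun n t r => ?_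
  rw [AddMonoidHom.comp_apply, ← Tens.tmul_rsmul, unitMap_rsmul, map_counitMap_assocInv,
    h.contract_η]
  rfl

theorem IsCoringPair.of_triangles (hR : IsFirmRing R) (hT : IsRightFirm R T)
    (hT' : IsLeftFirm A T) (hη : IsBilinear R R η) (hj : IsBilinear A R j)
    (left : ∀ r u, counitMap (Tens R R S) j hj (Tens.tmul R (unitMap hR η hη.1 r) u) =
      Tens.tmul R r u)
    (right : ∀ a t, Tens.map A (counitMap A j hj) (.id T) (counitMap_rightLinear hj)
      (IsLeftLinear.id A) (unitMap (hT.tens A R A T) η hη.1 (Tens.tmul A a t)) =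
        Tens.tmul A a t) :
    IsCoringPair η j where
  η_bilinear := hη
  j_bilinear := hj
  act_η r u := by
    let jη : R →+ Tens A S (Dual A S) :=
      (Tens.map A (.id S) j (IsRightLinear.id A) hj.1).comp η
    have jη_leftLinear : IsLeftLinear R jη :=
      (Tens.map_leftLinear (IsRightLinear.id A) hj.1 (IsLeftLinear.id R)).comp hη.1
    have act_jη_mul (s r : R) :
        ElementaryRing.act A S (jη (s •ᵣ r)) u = s •ₗ ElementaryRing.act A S (jη r) u :=
      (congrArg (ElementaryRing.act A S · u) (jη_leftLinear s r)).trans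
        (ElementaryRing.act_lsmul s (jη r) u)
    have tmul_act (s r : R) :
        Tens.tmul R s (ElementaryRing.act A S (jη r) u) = Tens.tmul R (s •ᵣ r) u :=
      (counitMap_assocInv hj s (η r) u).symm.trans
        ((congrArg (fun x => counitMap (Tens R R S) j hj (Tens.tmul R x u))
          (unitMap_rsmul hR hη.1 s r).symm).trans (left (s •ᵣ r) u))
    exact DFunLike.congr_fun (hR.hom_ext
      (f := ((ElementaryRing.act A S).flip u : Tens A S (Dual A S) →+ S).comp jη)
      (g := (lactHom R S).flip u) fun s r =>
        (act_jη_mul s r).trans (congrArg (lmulMap R S) (tmul_act s r))) r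
  contract_η t r := by
    have tmul_contract (a : A) (t : T) :
        Tens.tmul A a (Dual.contract T (j t) (η r)) = Tens.tmul A a (t •ᵣ r) := by
      rw [← map_counitMap_assocInv hj, ← unitMap_rsmul (hT.tens A R A T) hη.1]
      exact right a (t •ᵣ r)
    refine DFunLike.congr_fun (hT'.hom_ext (f := ((Dual.contract T).flip (η r)).comp j)
      (g := (ractHom R T).flip r) fun a t => ?_) t
    calc
      Dual.contract T (j (a •ₗ t)) (η r) = a •ₗ Dual.contract T (j t) (η r) := by
        rw [hj.1, Dual.contract_lsmul]
      _ = a •ₗ (t •ᵣ r) := congrArg (lmulMap A T) (tmul_contract a t)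
      _ = (a •ₗ t) •ᵣ r := (Bimodule.lsmul_rsmul a t r).symm

end UnitCounit

section Bundled

variable {R A : Type u} [NonUnitalRing R] [NonUnitalRing A] {S : FirmBimodule R A}
  {T : FirmBimodule A R}

theorem nonempty_comatrixCoringContext_iff :
    Nonempty (ComatrixCoringContext R A S T) ↔
      ∃ (η : R →+ Tens A S T) (j : T →+ Dual A S), IsCoringPair η j := by
  constructor
  · rintro ⟨c⟩
    exact ⟨c.η, Dual.ofPairing c.ε c.ε_bilinear.2, c.η_bilinear,
      Dual.ofPairing_bilinear c.ε_bilinear,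
      fun r u => (rmulMap_map_assocHom c.ε c.ε_bilinear (c.η r) u).symm.trans
        (c.left_comm (Tens.tmul R r u)),
      fun t r => (lmulMap_map_assocInv c.ε c.ε_bilinear t (c.η r)).symm.trans
        (c.right_comm (Tens.tmul R t r))⟩
  · rintro ⟨η, j, h⟩
    let ε : Tens R T S →+ A := Dual.pairing j h.j_bilinear.2
    have hε : IsBilinear A A ε := Dual.pairing_bilinear h.j_bilinear
    refine ⟨⟨η, ε, h.η_bilinear, hε, DFunLike.congr_fun (Tens.hom_ext R
      (f := ((rmulMap A S).comp (Tens.map A (.id S) ε (IsRightLinear.id A) hε.1)).comp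
        ((Tens.assocHom R A S T S).comp
          (Tens.map R η (.id S) h.η_bilinear.2 (IsLeftLinear.id R))))
      (g := lmulMap R S) fun r u => ?_), DFunLike.congr_fun (Tens.hom_ext R
      (f := ((lmulMap A T).comp (Tens.map A ε (.id T) hε.2 (IsLeftLinear.id A))).comp
        ((Tens.assocInv A R T S T).comp
          (Tens.map R (.id T) η (IsRightLinear.id R) h.η_bilinear.1)))
      (g := rmulMap R T) fun t r => ?_)⟩⟩
    · exact (rmulMap_map_assocHom ε hε (η r) u).trans (h.act_η r u)
    · exact (lmulMap_map_assocInv ε hε t (η r)).trans (h.contract_η t r)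

open FirmMod

/-- The adjunction `- ⊗_R S ⊣ - ⊗_A T` of a comatrix coring context. -/
noncomputable def IsCoringPair.adjunction {η : R →+ Tens A S T} {j : T →+ Dual A S}
    (h : IsCoringPair η j) : tensFunctor S ⊣ tensFunctor T where
  unit :=
    { app := fun M => Hom.mk (N := (tensFunctor T).obj ((tensFunctor S).obj M))
        (unitMap M.firm η h.η_bilinear.1) (unitMap_rightLinear M.firm h.η_bilinear)
      naturality := fun M M' f => Hom.ext
        (unitMap_naturality M.firm M'.firm h.η_bilinear.1 f.linear) }
  counit :=
    { app := fun N => Hom.mk (M := (tensFunctor S).obj ((tensFunctor T).obj N))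
        (counitMap N j h.j_bilinear) (counitMap_rightLinear h.j_bilinear)
      naturality := fun _ _ f => Hom.ext (counitMap_naturality h.j_bilinear f.linear) }
  left_triangle_components M := Hom.ext (h.counitMap_unitMap M.firm)
  right_triangle_components _ := Hom.ext (h.map_counitMap_unitMap T.rightFirm)

theorem IsFirmlyProjective.exists_isCoringPair_of_bimoduleIso (hR : IsFirmRing R)
    (h : IsFirmlyProjective A S R) (hT : BimoduleIso A R T (Tens R (Dual A S) R)) :
    ∃ (η : R →+ Tens A S T) (j : T →+ Dual A S), IsCoringPair η j := by
  obtain ⟨η, hη⟩ := exists_isCoringPair hR h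
  obtain ⟨e, he⟩ := hT
  exact ⟨_, _, hη.congr e he⟩

theorem IsFirmlyProjective.exists_firmBimodule_isCoringPair (hR : IsFirmRing R)
    (h : IsFirmlyProjective A S R) :
    ∃ (T : FirmBimodule A R) (η : R →+ Tens A S T) (j : T →+ Dual A S), IsCoringPair η j := by
  obtain ⟨η, hη⟩ := exists_isCoringPair hR h
  have rightFirm : IsRightFirm R (Tens R (Dual A S) R) := hR.tens R R (Dual A S) R
  exact ⟨⟨Tens R (Dual A S) R, hη.isLeftFirm rightFirm, rightFirm⟩, η, _, hη⟩

namespace FirmMod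

/-- The morphism `R → M`, `r ↦ m r`, of an element `m` of a firm module `M`. -/
def orbit (hR : IsFirmRing R) {M : FirmMod R} (m : M) : self R hR ⟶ M :=
  Hom.mk (M := self R hR) (@ractHom R M _ _ _ m) (@RightModule.rsmul_mul R M _ _ _ m)

section PairOfAdjunction

variable (adj : tensFunctor S ⊣ tensFunctor T)

/-- The map `R → S ⊗_A T` obtained from the unit `R → (R ⊗_R S) ⊗_A T` of an adjunction. -/
def coev (hR : IsFirmRing R) : R →+ Tens A S T :=
  (Tens.map A (lmulMap R S) (.id T) lmulMap_rightLinear (IsLeftLinear.id A)).comp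
    (adj.unit.app (self R hR)).hom

theorem unit_app_rsmul (hR : IsFirmRing R) (M : FirmMod R) (m : M) (r : R) :
    (adj.unit.app M).hom (m •ᵣ r) = Tens.assocInv A R M S T (Tens.tmul R m (coev adj hR r)) := by
  have map_orbit (x : Tens R R S) :
      ((tensFunctor S).map (orbit hR m)).hom x = Tens.tmul R m (lmulMap R S x) :=
    DFunLike.congr_fun (Tens.hom_ext R
      (f := (((tensFunctor S).map (orbit hR m)).hom : Tens R R S →+ Tens R M S))
      (g := (Tens.mk R M S m).comp (lmulMap R S)) fun s u => Tens.rsmul_tmul R m s u) x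
  have map_map_orbit (y : Tens A (Tens R R S) T) :
      ((tensFunctor T).map ((tensFunctor S).map (orbit hR m))).hom y =
        Tens.assocInv A R M S T (Tens.tmul R m (Tens.map A (lmulMap R S) (.id T)
          lmulMap_rightLinear (IsLeftLinear.id A) y)) :=
    DFunLike.congr_fun (Tens.hom_ext A
      (f := (((tensFunctor T).map ((tensFunctor S).map (orbit hR m))).hom :
        Tens A (Tens R R S) T →+ Tens A (Tens R M S) T))
      (g := ((Tens.assocInv A R M S T).comp (Tens.mk R M (Tens A S T) m)).comp
        (Tens.map A (lmulMap R S) (.id T) lmulMap_rightLinear (IsLeftLinear.id A)))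
      fun x t => congrArg (fun y : Tens R M S => Tens.tmul A y t) (map_orbit x)) y
  exact (congrArg (fun f => f.hom r) (adj.unit.naturality (orbit hR m))).trans
    (map_map_orbit ((adj.unit.app (self R hR)).hom r))

theorem coev_bilinear (hR : IsFirmRing R) : IsBilinear R R (coev adj hR) := by
  refine ⟨fun r s => ?_, (Tens.map_rightLinear lmulMap_rightLinear (IsLeftLinear.id A)
    (IsRightLinear.id R)).comp (adj.unit.app (self R hR)).linear⟩
  have map_lmulMap (x : Tens A S T) :
      Tens.map A (lmulMap R S) (.id T) lmulMap_rightLinear (IsLeftLinear.id A)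
        (Tens.assocInv A R R S T (Tens.tmul R r x)) = r •ₗ x :=
    DFunLike.congr_fun (Tens.hom_ext A
      (f := (Tens.map A (lmulMap R S) (.id T) lmulMap_rightLinear (IsLeftLinear.id A)).comp
        ((Tens.assocInv A R R S T).comp (Tens.mk R R (Tens A S T) r)))
      (g := lactHom R (Tens A S T) r) fun _ _ => rfl) x
  exact (congrArg (Tens.map A (lmulMap R S) (.id T) lmulMap_rightLinear (IsLeftLinear.id A))
    (unit_app_rsmul adj hR (self R hR) r s)).trans (map_lmulMap (coev adj hR s))

theorem unit_app_hom (hR : IsFirmRing R) (M : FirmMod R) :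
    (adj.unit.app M).hom = unitMap M.firm (coev adj hR) (coev_bilinear adj hR).1 :=
  M.firm.hom_ext fun m r =>
    (unit_app_rsmul adj hR M m r).trans (unitMap_rsmul M.firm (coev_bilinear adj hR).1 m r).symm

/-- The counit `(A ⊗_A T) ⊗_R S → A` of an adjunction at `A`. -/
def counitSelf (hA : IsFirmRing A) : Tens R (Tens A A T) S →+ A :=
  (adj.counit.app (self A hA)).hom

theorem counitSelf_bilinear (hA : IsFirmRing A) : IsBilinear A A (counitSelf adj hA) :=
  ⟨fun a x => congrArg (fun f => f.hom x) (adj.counit.naturality (mulLeft hA a)),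
    (adj.counit.app (self A hA)).linear⟩

/-- The map `T → S*` obtained from the counit `(A ⊗_A T) ⊗_R S → A` of an adjunction. -/
noncomputable def toDual (hA : IsFirmRing A) : T →+ Dual A S :=
  (Dual.ofPairing (counitSelf adj hA) (counitSelf_bilinear adj hA).2).comp
    T.leftFirm.mulEquiv.symm.toAddMonoidHom

theorem toDual_bilinear (hA : IsFirmRing A) : IsBilinear A R (toDual adj hA) := by
  have ofPairing_bilinear := Dual.ofPairing_bilinear (counitSelf_bilinear adj hA)
  exact ⟨ofPairing_bilinear.1.comp (IsLeftLinear.symm (e := T.leftFirm.mulEquiv)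
      lmulMap_leftLinear),
    ofPairing_bilinear.2.comp (IsRightLinear.symm (e := T.leftFirm.mulEquiv)
      lmulMap_rightLinear)⟩

theorem toDual_lsmul_apply (hA : IsFirmRing A) (a : A) (t : T) (u : S) :
    (toDual adj hA (a •ₗ t)).1 u =
      counitSelf adj hA (Tens.tmul R (Tens.tmul A a t) u) :=
  congrArg (fun x : Tens A A T => counitSelf adj hA (Tens.tmul R x u))
    (T.leftFirm.mulEquiv.symm_apply_apply (Tens.tmul A a t))

theorem counit_app_hom (hA : IsFirmRing A) (N : FirmMod A) :
    (adj.counit.app N).hom = counitMap N (toDual adj hA) (toDual_bilinear adj hA) := by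
  refine Tens.hom_ext_tmul_left fun n t u => ?_
  refine DFunLike.congr_fun (T.leftFirm.hom_ext
    (f := ((adj.counit.app N).hom : Tens R (Tens A N T) S →+ N).comp
      (((Tens.mk R (Tens A N T) S).flip u).comp (Tens.mk A N T n)))
    (g := (ractHom A N n).comp ((AddMonoidHom.eval u).comp
      ((Dual A S).subtype.comp (toDual adj hA)))) fun a t => ?_) t
  calc
    _ = (adj.counit.app N).hom (Tens.tmul R (Tens.tmul A (n •ᵣ a) t) u) :=
      congrArg (fun x : Tens A N T => (adj.counit.app N).hom (Tens.tmul R x u))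
        (Tens.rsmul_tmul A n a t).symm
    _ = n •ᵣ counitSelf adj hA (Tens.tmul R (Tens.tmul A a t) u) :=
      congrArg (fun f => f.hom (Tens.tmul R (Tens.tmul A a t) u))
        (adj.counit.naturality (orbit hA n))
    _ = n •ᵣ (toDual adj hA (a •ₗ t)).1 u :=
      congrArg (n •ᵣ ·) (toDual_lsmul_apply adj hA a t u).symm

theorem isCoringPair_of_adjunction (hR : IsFirmRing R) (hA : IsFirmRing A) :
    IsCoringPair (coev adj hR) (toDual adj hA) := by
  refine .of_triangles hR T.rightFirm T.leftFirm (coev_bilinear adj hR) (toDual_bilinear adj hA)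
    (fun r u => ?_) (fun a t => ?_)
  · let RS : FirmMod A := (tensFunctor S).obj (self R hR)
    have unit_eq : unitMap hR (coev adj hR) (coev_bilinear adj hR).1 r =
        (adj.unit.app (self R hR)).hom r :=
      DFunLike.congr_fun (unit_app_hom adj hR (self R hR)).symm r
    refine (congrArg (fun x => counitMap RS (toDual adj hA) (toDual_bilinear adj hA)
      (Tens.tmul R x u)) unit_eq).trans
        ((DFunLike.congr_fun (counit_app_hom adj hA RS) _).symm.trans ?_)
    exact congrArg (fun f => f.hom (Tens.tmul R r u)) (adj.left_triangle_components (self R hR))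
  · let TA : FirmMod R := (tensFunctor T).obj (self A hA)
    have counit_eq : Hom.mk (M := (tensFunctor S).obj TA) (N := self A hA)
        (counitMap A (toDual adj hA) (toDual_bilinear adj hA))
        (counitMap_rightLinear (toDual_bilinear adj hA)) = adj.counit.app (self A hA) :=
      Hom.ext (counit_app_hom adj hA (self A hA)).symm
    have unit_eq := DFunLike.congr_fun (unit_app_hom adj hR TA) (Tens.tmul A a t)
    refine (congrArg _ unit_eq.symm).trans ((congrArg (fun f => ((tensFunctor T).map f).hom
      ((adj.unit.app TA).hom (Tens.tmul A a t))) counit_eq).trans ?_)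
    exact congrArg (fun f => f.hom (Tens.tmul A a t))
      (adj.right_triangle_components (self A hA))

end PairOfAdjunction

end FirmMod

end Bundled

section RHom

/-- The group `Hom_R(M, N)` of right linear maps. -/
def RHom (R M N : Type*) [NonUnitalRing R] [AddCommGroup M] [AddCommGroup N] [RightModule R M]
    [RightModule R N] : AddSubgroup (M →+ N) where
  carrier := {f | IsRightLinear R f}
  zero_mem' := fun _ r => (zero_rsmul' r).symm
  add_mem' := fun {f g} hf hg m r => by
    rw [AddMonoidHom.add_apply, AddMonoidHom.add_apply, hf, hg, RightModule.add_rsmul]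
  neg_mem' := fun {f} hf m r => by
    rw [AddMonoidHom.neg_apply, AddMonoidHom.neg_apply, hf]
    exact (map_neg ((ractHom R N).flip r) (f m)).symm

variable {R A M N P T : Type*} [NonUnitalRing R] [NonUnitalRing A] [AddCommGroup M]
  [AddCommGroup N] [AddCommGroup P] [AddCommGroup T] [RightModule R M] [RightModule A N]
  [RightModule A P] [LeftModule A T] [RightModule R T] [Bimodule A R T]

instance : RightModule A (RHom R T M) where
  rsmul f a := ⟨f.1.comp (lactHom A T a), fun t r => by
    rw [AddMonoidHom.comp_apply, AddMonoidHom.comp_apply, lactHom_apply, lactHom_apply,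
      ← Bimodule.lsmul_rsmul, f.2]⟩
  add_rsmul _ _ _ := rfl
  rsmul_add f a b := Subtype.ext (AddMonoidHom.ext fun t =>
    (congrArg f.1 (LeftModule.add_lsmul a b t)).trans (map_add f.1 _ _))
  rsmul_mul f a b := Subtype.ext (AddMonoidHom.ext fun t =>
    congrArg f.1 (LeftModule.mul_lsmul a b t))

/-- The bijection `Hom_R(N ⊗_A T, M) ≃ Hom_A(N, Hom_R(T, M))`. -/
def RHom.curry : RHom R (Tens A N T) M ≃ RHom A N (RHom R T M) where
  toFun h := ⟨AddMonoidHom.mk' (fun n => ⟨h.1.comp (Tens.mk A N T n),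
      fun t => h.2 (Tens.tmul A n t)⟩)
    (fun n n' => Subtype.ext (AddMonoidHom.ext fun t =>
      (congrArg h.1 (Tens.add_tmul A n n' t)).trans (map_add h.1 _ _))),
    fun n a => Subtype.ext (AddMonoidHom.ext fun t => congrArg h.1 (Tens.rsmul_tmul A n a t))⟩
  invFun k := ⟨Tens.lift A ((RHom R T M).subtype.comp k.1)
      (fun n a t => congrArg (fun f : RHom R T M => f.1 t) (k.2 n a)),
    Tens.rightLinear_of_tmul fun n t r => (k.1 n).2 t r⟩
  left_inv _ := Subtype.ext (Tens.hom_ext A fun _ _ => rfl)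
  right_inv _ := rfl

namespace IsRightFirm

/-- The unique lift to `P ⊗_A A` of a right linear map `N → P` on a firm module `N`. -/
noncomputable def lift (hN : IsRightFirm A N) (f : RHom A N P) : N →+ Tens A P A :=
  (Tens.map A f.1 (.id A) f.2 (IsLeftLinear.id A)).comp hN.mulEquiv.symm.toAddMonoidHom

theorem lift_rsmul (hN : IsRightFirm A N) (f : RHom A N P) (n : N) (a : A) :
    hN.lift f (n •ᵣ a) = Tens.tmul A (f.1 n) a :=
  congrArg (Tens.map A f.1 (.id A) f.2 (IsLeftLinear.id A)) (hN.mulEquiv_symm_rsmul n a)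

/-- The bijection `Hom_A(N, P) ≃ Hom_A(N, P ⊗_A A)` for a firm module `N`. -/
noncomputable def liftEquiv (hN : IsRightFirm A N) : RHom A N P ≃ RHom A N (Tens A P A) where
  toFun f := ⟨hN.lift f,
    (Tens.map_rightLinear f.2 (IsLeftLinear.id A) (IsRightLinear.id A)).comp
      hN.mulEquiv_symm_rightLinear⟩
  invFun g := ⟨(rmulMap A P).comp g.1, rmulMap_rightLinear.comp g.2⟩
  left_inv f := Subtype.ext (AddMonoidHom.ext fun n =>
    (rmulMap_map f.2 (hN.mulEquiv.symm n)).trans (congrArg f.1 (hN.mulEquiv.apply_symm_apply n)))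
  right_inv g := Subtype.ext (hN.hom_ext fun n a => (hN.lift_rsmul _ n a).trans
    ((Tens.rsmul_eq_rmulMap_tmul (g.1 n) a).symm.trans (g.2 n a).symm))

end IsRightFirm

end RHom

namespace FirmMod

variable {R A : Type u} [NonUnitalRing R] [NonUnitalRing A]

/-- Morphisms of firm modules as elements of the group of right linear maps. -/
def homEquiv {M N : FirmMod R} : (M ⟶ N) ≃ RHom R M N where
  toFun f := ⟨f.hom, f.linear⟩
  invFun f := ⟨f.1, f.2⟩
  left_inv _ := rfl
  right_inv _ := rfl

/-- The value at `M` of the right adjoint of `- ⊗_A T`: the firm module `Hom_R(T, M) ⊗_A A`. -/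
def coHom (hA : IsFirmRing A) (T : FirmBimodule A R) (M : FirmMod R) : FirmMod A :=
  ⟨Tens A (RHom R T M) A, hA.tens A A (RHom R T M) A⟩

/-- The bijection `Hom_R(N ⊗_A T, M) ≃ Hom_A(N, Hom_R(T, M) ⊗_A A)`. -/
noncomputable def curryEquiv (hA : IsFirmRing A) (T : FirmBimodule A R) (N : FirmMod A)
    (M : FirmMod R) : ((tensFunctor T).obj N ⟶ M) ≃ (N ⟶ coHom hA T M) :=
  homEquiv.trans ((RHom.curry (A := A)).trans (N.firm.liftEquiv.trans
    (homEquiv (N := coHom hA T M)).symm))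

theorem curryEquiv_rsmul (hA : IsFirmRing A) {T : FirmBimodule A R} {N : FirmMod A}
    {M : FirmMod R} (h : (tensFunctor T).obj N ⟶ M) (n : N) (a : A) :
    (curryEquiv hA T N M h).hom (n •ᵣ a) =
      Tens.tmul A ((RHom.curry (A := A) (homEquiv h)).1 n) a :=
  N.firm.lift_rsmul (RHom.curry (A := A) (homEquiv h)) n a

theorem curryEquiv_naturality (hA : IsFirmRing A) (T : FirmBimodule A R) (N' N : FirmMod A)
    (M : FirmMod R) (f : N' ⟶ N) (g : (tensFunctor T).obj N ⟶ M) :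
    curryEquiv hA T N' M ((tensFunctor T).map f ≫ g) = f ≫ curryEquiv hA T N M g :=
  Hom.ext (N'.firm.hom_ext fun n a => (curryEquiv_rsmul hA _ n a).trans
    ((congrArg (curryEquiv hA T N M g).hom (f.linear n a)).trans
      (curryEquiv_rsmul hA g (f.hom n) a)).symm)

theorem valueAtRingIso_tensFunctor (hR : IsFirmRing R) (S : FirmBimodule R A) :
    ValueAtRingIso hR (tensFunctor S) S :=
  ⟨S.leftFirm.mulEquiv, lmulMap_rightLinear (R := R), fun r => DFunLike.congr_fun (Tens.hom_ext R
    (f := (lmulMap R S).comp (((tensFunctor S).map (mulLeft hR r)).hom :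
      Tens R R S →+ Tens R R S))
    (g := (lactHom R S r).comp (lmulMap R S)) fun s u => LeftModule.mul_lsmul r s u)⟩

theorem hasAdjointTriple_of_adjunction (hR : IsFirmRing R) (hA : IsFirmRing A)
    {S : FirmBimodule R A} {T : FirmBimodule A R} (adj : tensFunctor S ⊣ tensFunctor T) :
    HasAdjointTriple hR S :=
  ⟨tensFunctor S, tensFunctor T, _, ⟨adj⟩,
    ⟨Adjunction.adjunctionOfEquivRight (curryEquiv hA T) (curryEquiv_naturality hA T)⟩,
    valueAtRingIso_tensFunctor hR S⟩

end FirmMod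

section Biproducts

section RightFirm

variable {R : Type*} [NonUnitalRing R]

instance (M N : Type*) [AddCommGroup M] [AddCommGroup N] [RightModule R M] [RightModule R N] :
    RightModule R (M × N) where
  rsmul x r := (x.1 •ᵣ r, x.2 •ᵣ r)
  add_rsmul _ _ r := Prod.ext (RightModule.add_rsmul _ _ r) (RightModule.add_rsmul _ _ r)
  rsmul_add _ r s := Prod.ext (RightModule.rsmul_add _ r s) (RightModule.rsmul_add _ r s)
  rsmul_mul _ r s := Prod.ext (RightModule.rsmul_mul _ r s) (RightModule.rsmul_mul _ r s)

instance : RightModule R PUnit where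
  rsmul _ _ := 0
  add_rsmul _ _ _ := rfl
  rsmul_add _ _ _ := rfl
  rsmul_mul _ _ _ := rfl

variable {M N : Type*} [AddCommGroup M] [AddCommGroup N] [RightModule R M] [RightModule R N]

theorem inl_rightLinear : IsRightLinear R (AddMonoidHom.inl M N) := fun _ r =>
  Prod.ext rfl (zero_rsmul' r).symm

theorem inr_rightLinear : IsRightLinear R (AddMonoidHom.inr M N) := fun _ r =>
  Prod.ext (zero_rsmul' r).symm rfl

theorem IsRightFirm.prod (hM : IsRightFirm R M) (hN : IsRightFirm R N) :
    IsRightFirm R (M × N) := by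
  let i : Tens R M R →+ Tens R (M × N) R :=
    Tens.map R (.inl M N) (.id R) inl_rightLinear (IsLeftLinear.id R)
  let j : Tens R N R →+ Tens R (M × N) R :=
    Tens.map R (.inr M N) (.id R) inr_rightLinear (IsLeftLinear.id R)
  refine .of_section ((i.comp hM.mulEquiv.symm.toAddMonoidHom).coprod
    (j.comp hN.mulEquiv.symm.toAddMonoidHom)) (fun x => ?_) (fun x r => ?_)
  · calc
      _ = rmulMap R (M × N) (i (hM.mulEquiv.symm x.1)) +
          rmulMap R (M × N) (j (hN.mulEquiv.symm x.2)) := map_add _ _ _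
      _ = AddMonoidHom.inl M N (hM.mulEquiv (hM.mulEquiv.symm x.1)) +
          AddMonoidHom.inr M N (hN.mulEquiv (hN.mulEquiv.symm x.2)) :=
        congrArg₂ (· + ·) (rmulMap_map inl_rightLinear _) (rmulMap_map inr_rightLinear _)
      _ = x := by
        rw [AddEquiv.apply_symm_apply, AddEquiv.apply_symm_apply]
        exact Prod.fst_add_snd x
  · calc
      _ = i (Tens.tmul R x.1 r) + j (Tens.tmul R x.2 r) :=
        congrArg₂ (fun y z => i y + j z) (hM.mulEquiv_symm_rsmul x.1 r)
          (hN.mulEquiv_symm_rsmul x.2 r)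
      _ = Tens.tmul R ((x.1, 0) + (0, x.2)) r := (Tens.add_tmul R _ _ r).symm
      _ = Tens.tmul R x r := congrArg (Tens.tmul R · r) (Prod.fst_add_snd x)

theorem isRightFirm_punit : IsRightFirm R PUnit :=
  .of_section 0 (fun _ => rfl) fun _ r => (Tens.zero_tmul r).symm

end RightFirm

namespace FirmMod

variable {R : Type u} [NonUnitalRing R]

instance : Preadditive (FirmMod R) where
  homGroup _ _ := homEquiv.addCommGroup
  add_comp _ _ _ f g h := Hom.ext (AddMonoidHom.ext fun x => map_add h.hom (f.hom x) (g.hom x))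
  comp_add _ _ _ _ _ _ := rfl

/-- The product of two firm modules, as a biproduct. -/
def prodBicone (M N : FirmMod R) : Limits.BinaryBicone M N where
  pt := ⟨M × N, M.firm.prod N.firm⟩
  fst := Hom.mk (M := ⟨M × N, M.firm.prod N.firm⟩) (.fst M N) (fun _ _ => rfl)
  snd := Hom.mk (M := ⟨M × N, M.firm.prod N.firm⟩) (.snd M N) (fun _ _ => rfl)
  inl := Hom.mk (N := ⟨M × N, M.firm.prod N.firm⟩) (.inl M N) inl_rightLinear
  inr := Hom.mk (N := ⟨M × N, M.firm.prod N.firm⟩) (.inr M N) inr_rightLinear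

instance : Limits.HasBinaryBiproducts (FirmMod R) where
  has_binary_biproduct M N := .mk
    { bicone := prodBicone M N
      isBilimit := Limits.isBinaryBilimitOfTotal _ (Hom.ext (AddMonoidHom.ext fun x =>
        Prod.fst_add_snd (M := M) (N := N) x)) }

instance : Limits.HasZeroObject (FirmMod R) :=
  ⟨⟨PUnit.{u + 1}, isRightFirm_punit⟩, (Limits.IsZero.iff_id_eq_zero _).2
    (Hom.ext (AddMonoidHom.ext fun _ => rfl))⟩

instance {A : Type u} [NonUnitalRing A] (F : FirmMod R ⥤ FirmMod A) [F.IsLeftAdjoint] :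
    F.Additive :=
  have := Limits.preservesBinaryBiproducts_of_preservesBinaryCoproducts F
  Functor.additive_of_preservesBinaryBiproducts F

end FirmMod

end Biproducts

section EilenbergWatts

namespace FirmMod

variable {R A : Type u} [NonUnitalRing R] [NonUnitalRing A]

theorem orbit_add (hR : IsFirmRing R) {M : FirmMod R} (m m' : M) :
    orbit hR (m + m') = orbit hR m + orbit hR m' :=
  Hom.ext (map_add (ractHom R M) m m')

theorem orbit_rsmul (hR : IsFirmRing R) {M : FirmMod R} (m : M) (r : R) :
    orbit hR (m •ᵣ r) = mulLeft hR r ≫ orbit hR m :=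
  Hom.ext (AddMonoidHom.ext fun s => (RightModule.rsmul_mul m r s).symm)

theorem orbit_comp (hR : IsFirmRing R) {M N : FirmMod R} (m : M) (f : M ⟶ N) :
    orbit hR m ≫ f = orbit hR (f.hom m) :=
  Hom.ext (AddMonoidHom.ext fun r => f.linear m r)

theorem mulLeft_add (hR : IsFirmRing R) (r s : R) :
    mulLeft hR (r + s) = mulLeft hR r + mulLeft hR s :=
  Hom.ext (AddMonoidHom.ext fun t => add_mul r s t)

theorem mulLeft_mul (hR : IsFirmRing R) (r s : R) :
    mulLeft hR (r * s) = mulLeft hR s ≫ mulLeft hR r :=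
  Hom.ext (AddMonoidHom.ext fun t => mul_assoc r s t)

theorem hom_ext_orbit (hR : IsFirmRing R) {M N : FirmMod R} {f g : M ⟶ N}
    (h : ∀ m : M, orbit hR m ≫ f = orbit hR m ≫ g) : f = g :=
  Hom.ext (M.firm.hom_ext fun m r => congrArg (fun k => k.hom r) (h m))

theorem bijective_of_isIso {M N : FirmMod R} (f : M ⟶ N) [IsIso f] :
    Function.Bijective f.hom :=
  Function.bijective_iff_has_inverse.2 ⟨(inv f).hom,
    fun x => congrArg (fun k => k.hom x) (IsIso.hom_inv_id f),
    fun x => congrArg (fun k => k.hom x) (IsIso.inv_hom_id f)⟩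

theorem exists_orbit_comp_eq (hR : IsFirmRing R) {M N : FirmMod R} (q : M →+ (self R hR ⟶ N))
    (hq : ∀ m r, q (m •ᵣ r) = mulLeft hR r ≫ q m) :
    ∃ k : M ⟶ N, ∀ m : M, orbit hR m ≫ k = q m := by
  let evalLift : Tens R M R →+ N := Tens.lift R
    (AddMonoidHom.mk' (fun m => ((q m).hom : R →+ N))
      (fun m m' => congrArg Hom.hom (map_add q m m')))
    (fun m r s => congrArg (fun f => f.hom s) (hq m r))
  have evalLift_linear : IsRightLinear R evalLift :=
    Tens.rightLinear_of_tmul fun m s r => (q m).linear s r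
  exact ⟨⟨evalLift.comp M.firm.mulEquiv.symm.toAddMonoidHom,
    evalLift_linear.comp M.firm.mulEquiv_symm_rightLinear⟩,
    fun m => Hom.ext (AddMonoidHom.ext fun r =>
      congrArg evalLift (M.firm.mulEquiv_symm_rsmul m r))⟩

section Additive

variable (hR : IsFirmRing R) (F : FirmMod R ⥤ FirmMod A) [F.Additive]

instance : LeftModule R (F.obj (self R hR)) where
  lsmul r x := (F.map (mulLeft hR r)).hom x
  lsmul_add r := map_add (F.map (mulLeft hR r)).hom
  add_lsmul r s x := by rw [mulLeft_add, F.map_add]; rfl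
  mul_lsmul r s x := by rw [mulLeft_mul, F.map_comp]; rfl

instance : Bimodule R A (F.obj (self R hR)) where
  lsmul_rsmul r x a := ((F.map (mulLeft hR r)).linear x a).symm

/-- The firm module `M ⊗_R F(R)`. -/
def tensValue (M : FirmMod R) : FirmMod A :=
  ⟨Tens R M (F.obj (self R hR)), (F.obj (self R hR)).firm.tens R A M _⟩

/-- The Eilenberg-Watts comparison map `M ⊗_R F(R) → F(M)`, `m ⊗ x ↦ F(r ↦ m r)(x)`. -/
def watts (M : FirmMod R) : tensValue hR F M ⟶ F.obj M :=
  Hom.mk (M := tensValue hR F M)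
    (Tens.lift R
      (AddMonoidHom.mk' (fun m => (F.map (orbit hR m)).hom) fun m m' => by
        rw [orbit_add, F.map_add]; rfl)
      fun m r x => by
        change (F.map (orbit hR (m •ᵣ r))).hom x =
          (F.map (mulLeft hR r) ≫ F.map (orbit hR m)).hom x
        rw [orbit_rsmul, F.map_comp])
    (Tens.rightLinear_of_tmul fun m => (F.map (orbit hR m)).linear)

theorem watts_naturality {M N : FirmMod R} (f : M ⟶ N) (m : M) (x : F.obj (self R hR)) :
    (watts hR F N).hom (Tens.tmul R (f.hom m) x) =
      (F.map f).hom ((watts hR F M).hom (Tens.tmul R m x)) := by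
  change (F.map (orbit hR (f.hom m))).hom x = (F.map (orbit hR m) ≫ F.map f).hom x
  rw [← F.map_comp, orbit_comp]

variable {F} {G : FirmMod A ⥤ FirmMod R} (adj : F ⊣ G) (M : FirmMod R) (N : FirmMod A)
include adj

theorem watts_comp_injective :
    Function.Injective fun f : F.obj M ⟶ N => watts hR F M ≫ f := by
  refine fun f g hfg => (adj.homEquiv M N).injective (hom_ext_orbit hR fun m => ?_)
  rw [← adj.homEquiv_naturality_left, ← adj.homEquiv_naturality_left]
  exact congrArg _ (Hom.ext (AddMonoidHom.ext fun x =>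
    congrArg (fun k => k.hom (Tens.tmul R m x)) hfg))

theorem watts_comp_surjective :
    Function.Surjective fun f : F.obj M ⟶ N => watts hR F M ≫ f := by
  intro h
  let p : M →+ (F.obj (self R hR) ⟶ N) := AddMonoidHom.mk'
    (fun m => ⟨(h.hom : Tens R M (F.obj (self R hR)) →+ N).comp (Tens.mk R M _ m),
      fun x => h.linear (Tens.tmul R m x)⟩)
    (fun m m' => Hom.ext (AddMonoidHom.ext fun x =>
      (congrArg h.hom (Tens.add_tmul R m m' x)).trans (map_add h.hom _ _)))
  have p_rsmul (m : M) (r : R) : p (m •ᵣ r) = F.map (mulLeft hR r) ≫ p m :=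
    Hom.ext (AddMonoidHom.ext fun x => congrArg h.hom (Tens.rsmul_tmul R m r x))
  obtain ⟨k, hk⟩ := exists_orbit_comp_eq hR
    ((adj.homAddEquiv (self R hR) N).toAddMonoidHom.comp p) fun m r =>
      (congrArg _ (p_rsmul m r)).trans (adj.homEquiv_naturality_left _ _)
  have map_orbit_comp (m : M) : F.map (orbit hR m) ≫ (adj.homEquiv M N).symm k = p m := by
    rw [← adj.homEquiv_naturality_left_symm, hk]
    exact (adj.homEquiv _ _).symm_apply_apply (p m)
  exact ⟨(adj.homEquiv M N).symm k, Hom.ext (Tens.hom_ext R fun m x =>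
    congrArg (fun f => f.hom x) (map_orbit_comp m))⟩

end Additive

section LeftAdjoint

variable (hR : IsFirmRing R) (F : FirmMod R ⥤ FirmMod A) [F.IsLeftAdjoint]

instance isIso_watts (M : FirmMod R) : IsIso (watts hR F M) :=
  isIso_of_coyoneda_map_bijective _ fun N =>
    ⟨watts_comp_injective hR (.ofIsLeftAdjoint F) M N,
      watts_comp_surjective hR (.ofIsLeftAdjoint F) M N⟩

theorem isLeftFirm_obj_self : IsLeftFirm R (F.obj (self R hR)) := by
  have lmulMap_eq : lmulMap R (F.obj (self R hR)) = (watts hR F (self R hR)).hom :=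
    Tens.hom_ext R fun _ _ => rfl
  rw [IsLeftFirm, lmulMap_eq]
  exact bijective_of_isIso (watts hR F (self R hR))

/-- The firm bimodule `F(R)` of a left adjoint functor `F`. -/
def valueAtRing : FirmBimodule R A :=
  ⟨F.obj (self R hR), isLeftFirm_obj_self hR F, (F.obj (self R hR)).firm⟩

/-- The Eilenberg-Watts isomorphism `- ⊗_R F(R) ≅ F`. -/
noncomputable def wattsIso : tensFunctor (valueAtRing hR F) ≅ F :=
  NatIso.ofComponents (fun M => @asIso _ _ _ _ _ (isIso_watts hR F M))
    fun f => Hom.ext (Tens.hom_ext R (watts_naturality hR F f))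

theorem bimoduleIso_valueAtRing {S : FirmBimodule R A} (h : ValueAtRingIso hR F S) :
    BimoduleIso R A (valueAtRing hR F) S :=
  let ⟨e, he, he'⟩ := h
  ⟨e, he', he⟩

end LeftAdjoint

theorem nonempty_tensFunctor_iso {S S' : FirmBimodule R A} (h : BimoduleIso R A S S') :
    Nonempty (tensFunctor S ≅ tensFunctor S') := by
  obtain ⟨e, he⟩ := h
  let map {S S' : FirmBimodule R A} {f : S →+ S'} (hf : IsBilinear R A f) (M : FirmMod R) :
      (tensFunctor S).obj M ⟶ (tensFunctor S').obj M :=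
    Hom.mk (M := (tensFunctor S).obj M) (N := (tensFunctor S').obj M)
      (Tens.map R (.id M) f (IsRightLinear.id R) hf.1)
      (Tens.map_rightLinear (IsRightLinear.id R) hf.1 hf.2)
  exact ⟨NatIso.ofComponents (fun M =>
    { hom := map he M
      inv := map ⟨he.1.symm, he.2.symm⟩ M
      hom_inv_id := Hom.ext (DFunLike.ext _ _ (Tens.congrRight M e he.1).symm_apply_apply)
      inv_hom_id := Hom.ext (DFunLike.ext _ _ (Tens.congrRight M e he.1).apply_symm_apply) })
    fun f => Hom.ext (Tens.hom_ext R fun _ _ => rfl)⟩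

theorem exists_adjunction_of_hasAdjointTriple (hR : IsFirmRing R) (hA : IsFirmRing A)
    {S : FirmBimodule R A} (h : HasAdjointTriple hR S) :
    ∃ T : FirmBimodule A R, Nonempty (tensFunctor S ⊣ tensFunctor T) := by
  obtain ⟨F, G, H, ⟨adjF⟩, ⟨adjG⟩, hS⟩ := h
  have : F.IsLeftAdjoint := adjF.isLeftAdjoint
  have : G.IsLeftAdjoint := adjG.isLeftAdjoint
  obtain ⟨i⟩ := nonempty_tensFunctor_iso (bimoduleIso_valueAtRing hR F hS)
  exact ⟨valueAtRing hA G,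
    ⟨(adjF.ofNatIsoLeft ((wattsIso hR F).symm ≪≫ i)).ofNatIsoRight (wattsIso hA G).symm⟩⟩

end FirmMod

end EilenbergWatts

end FirmRings

theorem theorem2p4 (R A : Type u) [NonUnitalRing R] [NonUnitalRing A]
    (hR : IsFirmRing R) (hA : IsFirmRing A) (S : FirmBimodule R A) :
    List.TFAE [
      IsFirmlyProjective A S R,
      ∃ T : FirmBimodule A R, Nonempty (ComatrixCoringContext R A S T),
      ∃ T : FirmBimodule A R,
        Nonempty (FirmMod.tensFunctor S ⊣ FirmMod.tensFunctor T),
      HasAdjointTriple hR S] ∧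
    ∀ T : FirmBimodule A R,
      List.TFAE [
        IsFirmlyProjective A S R ∧ BimoduleIso A R T (Tens R (Dual A S) R),
        Nonempty (ComatrixCoringContext R A S T),
        Nonempty (FirmMod.tensFunctor S ⊣ FirmMod.tensFunctor T)] := by
  simp only [nonempty_comatrixCoringContext_iff]
  constructor
  · tfae_have 1 → 2 := fun h => h.exists_firmBimodule_isCoringPair hR
    tfae_have 2 → 1 := fun ⟨_, _, _, h⟩ => h.isFirmlyProjective S.leftFirm
    tfae_have 2 → 3 := fun ⟨T, _, _, h⟩ => ⟨T, ⟨h.adjunction⟩⟩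
    tfae_have 3 → 2 := fun ⟨T, ⟨adj⟩⟩ => ⟨T, _, _, FirmMod.isCoringPair_of_adjunction adj hR hA⟩
    tfae_have 3 → 4 := fun ⟨_, ⟨adj⟩⟩ => FirmMod.hasAdjointTriple_of_adjunction hR hA adj
    tfae_have 4 → 3 := FirmMod.exists_adjunction_of_hasAdjointTriple hR hA
    tfae_finish
  · intro T
    tfae_have 1 → 2 := fun ⟨h, hT⟩ => h.exists_isCoringPair_of_bimoduleIso hR hT
    tfae_have 2 → 1 := fun ⟨_, _, h⟩ =>
      ⟨h.isFirmlyProjective S.leftFirm, h.bimoduleIso hR T.rightFirm⟩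
    tfae_have 2 → 3 := fun ⟨_, _, h⟩ => ⟨h.adjunction⟩
    tfae_have 3 → 2 := fun ⟨adj⟩ => ⟨_, _, FirmMod.isCoringPair_of_adjunction adj hR hA⟩
    tfae_finish
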